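/- **Model.** Let $K\ge 1$, and for each tier $j\in\{1,\dots,K\}$ let $\lambda_j>0$ (base-station density), $P_j>0$ (transmit power), $M_j\ge 2$ (number of antennas), $\phi_j\in(0,1]$ (power allocation ratio) and $A_j\in[0,1]$ (activation probability of a base station). Let $\lambda_e>0$ be the density of the eavesdroppers (Eves), $N_0>0$ the noise power, $\beta_e>0$ the SINR threshold, $\alpha>2$ the path-loss exponent, and $\delta=2/\alpha$. In the plane, let $\Phi_1,\dots,\Phi_K,\Phi_e$ be independent homogeneous Poisson point processes with densities $\lambda_1,\dots,\lambda_K,\lambda_e$. They are the locations of the base stations of each tier other than the serving one, and of the Eves. The serving base station belongs to tier $k$ and lies at a fixed point $b$. Every base station of $\Phi_j$ is active independently with probability $A_j$; the active ones form $\Phi_j^o$. (In particular $A_j$ may be $1-\exp\bigl(-\lambda_u(P_jM_j)^{\delta}\,\Xi^{-1}(1-e^{-\pi\tau^{-\delta}\Xi})\bigr)$ with $\Xi=\sum_i\lambda_i(P_iM_i)^{\delta}$, for any user density $\lambda_u>0$ and access threshold $\tau>0$.) All channel vectors $\mathbf h_{ze}\in\mathbb C^{M_j}$ from a tier-$j$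 base station at $z$ to an Eve at $e$, and $\mathbf h_z\in\mathbb C^{M_j}$ from it to its served user, have i.i.d. $\mathcal{CN}(0,1)$ entries. Channels, activities and locations are all independent. Put $\mathbf w_z=\mathbf h_z^\dagger/\|\mathbf h_z\|$, and let $\mathbf W_z\in\mathbb C^{M_j\times(M_j-1)}$ be a measurable function of $\mathbf h_z$ such that the columns of $[\mathbf w_z\ \mathbf W_z]$ form an orthonormal basis of $\mathbb C^{M_j}$. For $e\in\Phi_e$ let $$\mathrm{SINR}_{e,k}=\frac{\phi_kP_k|\mathbf h_{be}^{T}\mathbf w_b|^2\,|b-e|^{-\alpha}}{\frac{(1-\phi_k)P_k\|\mathbf h_{be}^{T}\mathbf W_b\|^2}{(M_k-1)|b-e|^{\alpha}}+\sum_{j}\sum_{z\in\Phi_j^o}\frac{(1-\phi_j)P_j\|\mathbf h_{ze}^{T}\mathbf W_z\|^2}{(M_j-1)|z-e|^{\alpha}}+N_0},$$ and define the secrecy probability of tier $k$ by $$\mathcal P_{s,k}=\mathbb E\Bigl[\prod_{e\in\Phi_e}\mathbb P\bigl\{\mathrm{SINR}_{e,k}<\beta_e\,\big|\,\Phi_e,\Phi_1,\dots,\Phi_K\bigr\}\Bigr].$$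 **Notation.** Let $\xi_j=\frac{\phi_j^{-1}-1}{M_j-1}$, $C_{\alpha,m}=\frac{\Gamma(m-1+\delta)\Gamma(1-\delta)}{\Gamma(m-1)}$, $\psi_k=\sum_jA_j\lambda_jC_{\alpha,M_j}\bigl(\xi_j\frac{\phi_j}{\phi_k}\frac{P_j}{P_k}\bigr)^{\delta}$, $\gamma_k=\frac{4\beta_eN_0}{\pi^2\phi_kP_k}$ and $\Omega(x)=\frac1{\sqrt\pi}\int_0^{x^2}\frac{e^{-t}}{\sqrt t}\,dt$. Let $$\mathcal P^L_{s,k}=\exp\Bigl(-\tfrac{\pi\lambda_e}{(1+\xi_k\beta_e)^{M_k-1}}\int_0^\infty e^{-\frac{\beta_eN_0}{\phi_kP_k}r^{\alpha/2}-\pi\psi_k\beta_e^{\delta}r}\,dr\Bigr),$$ $$\mathcal P^U_{s,k}=1-\tfrac{\pi\lambda_e}{(1+\xi_k\beta_e)^{M_k-1}}\int_0^\infty e^{-\frac{\beta_eN_0}{\phi_kP_k}r^{\alpha/2}-\pi\psi_k\beta_e^{\delta}r-\pi\lambda_er}\,dr .$$ **Corollary 2.** Let $\alpha=4$. Then, for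 every tier $k$, $$\mathcal P^L_{s,k}\le\mathcal P_{s,k}\le\mathcal P^U_{s,k},$$ and the two bounds have the closed forms $$\mathcal P^L_{s,k}=\exp\left(-\frac{\sqrt\pi\,\lambda_e\,e^{\psi_k^2\beta_e^{2\delta}/\gamma_k}}{\sqrt{\gamma_k}\,(1+\xi_k\beta_e)^{M_k-1}}\left(1-\Omega\Bigl(\frac{\psi_k\beta_e^{\delta}}{\sqrt{\gamma_k}}\Bigr)\right)\right),$$ $$\mathcal P^U_{s,k}=1-\frac{\sqrt\pi\,\lambda_e\,e^{(\lambda_e+\psi_k\beta_e^{\delta})^2/\gamma_k}}{\sqrt{\gamma_k}\,(1+\xi_k\beta_e)^{M_k-1}}\left(1-\Omega\Bigl(\frac{\lambda_e+\psi_k\beta_e^{\delta}}{\sqrt{\gamma_k}}\Bigr)\right).$$ -/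

import Mathlib

open MeasureTheory ProbabilityTheory
open scoped ENNReal NNReal Matrix

namespace SecrecyHCN

noncomputable section

/-- The Euclidean plane. -/
abbrev Plane : Type := EuclideanSpace ℝ (Fin 2)

/-! ### Poisson point processes -/

/-- The random counting measure `B ↦ #{n | X n ω ∈ B}` of a sequence of random points. -/
def pointCount {Ω : Type*} (X : ℕ → Ω → Plane) (ω : Ω) : Measure Plane :=
  Measure.sum fun n => Measure.dirac (X n ω)

/-- The random points `X 0, X 1, …` form a homogeneous Poisson point process on the plane with
density `lam`: the number of points in a Borel set `B` of finite area is Poisson distributed with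
mean `lam * area B`, and the numbers of points in disjoint such sets are independent. -/
structure IsPoissonProcess {Ω : Type*} [MeasurableSpace Ω] (P : Measure Ω) (lam : ℝ)
    (X : ℕ → Ω → Plane) : Prop where
  measurable : ∀ n, Measurable (X n)
  count_law : ∀ B : Set Plane, MeasurableSet B → volume B ≠ ∞ →
    HasLaw (fun ω => pointCount X ω B)
      ((poissonMeasure (lam.toNNReal * (volume B).toNNReal)).map (Nat.cast : ℕ → ℝ≥0∞)) P
  count_indep : ∀ (m : ℕ) (B : Fin m → Set Plane), (∀ i, MeasurableSet (B i)) →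
    (∀ i, volume (B i) ≠ ∞) → Pairwise (fun i i' => Disjoint (B i) (B i')) →
    iIndepFun (fun i ω => pointCount X ω (B i)) P

/-! ### Rayleigh fading -/

/-- The circularly symmetric complex Gaussian law `CN(0, 1)`: real and imaginary parts are
independent real Gaussians of variance `1/2`. -/
def complexGaussian : Measure ℂ :=
  ((gaussianReal 0 (1 / 2)).prod (gaussianReal 0 (1 / 2))).map
    (fun p : ℝ × ℝ => (p.1 : ℂ) + (p.2 : ℂ) * Complex.I)

instance : IsProbabilityMeasure complexGaussian :=
  Measure.isProbabilityMeasure_map (by fun_prop)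

/-- The law of a channel vector with `M` i.i.d. `CN(0, 1)` entries. -/
def channelLaw (M : ℕ) : Measure (Fin M → ℂ) := Measure.pi fun _ => complexGaussian

instance (M : ℕ) : IsProbabilityMeasure (channelLaw M) := by
  unfold channelLaw; infer_instance

/-! ### Beamforming and artificial noise -/

/-- The beamforming vector `w = h† / ‖h‖` (entrywise conjugate, so that `hᵀ w = ‖h‖`). -/
def beam {M : ℕ} (h : Fin M → ℂ) : Fin M → ℂ :=
  fun l => star (h l) / ((Real.sqrt (∑ i, ‖h i‖ ^ 2) : ℝ) : ℂ)

/-- A choice of the artificial-noise weight matrix `W` as a measurable function of the channel `h`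
of the served user, such that the columns of `[w W]` form an orthonormal basis of `ℂ ^ M`
(the vector `w` itself always has norm one for `h ≠ 0`). -/
structure NoisePrecoder (M : ℕ) where
  W : (Fin M → ℂ) → Matrix (Fin M) (Fin (M - 1)) ℂ
  measurable : ∀ i l, Measurable fun h => W h i l
  orthonormal : ∀ h, h ≠ 0 → (W h)ᴴ * W h = 1
  orthogonal : ∀ h, h ≠ 0 → (W h)ᴴ *ᵥ beam h = 0

/-- `|gᵀ w|²`: gain over the channel `g` of the signal beamformed for the channel `h`. -/
def signalGain {M : ℕ} (h g : Fin M → ℂ) : ℝ := ‖g ⬝ᵥ beam h‖ ^ 2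

/-- `‖gᵀ W‖²`: gain over the channel `g` of the artificial noise of a base station whose
served user has channel `h`. -/
def noiseGain {M : ℕ} (V : NoisePrecoder M) (h g : Fin M → ℂ) : ℝ :=
  ∑ l, ‖(g ᵥ* V.W h) l‖ ^ 2

/-! ### The network -/

/-- The parameters of a `K`-tier network with eavesdroppers. -/
structure Network (K : ℕ) where
  /-- path-loss exponent -/
  alpha : ℝ
  /-- densities of the base stations -/
  lam : Fin K → ℝ
  /-- total transmit powers -/
  pow : Fin K → ℝ
  /-- numbers of antennas -/
  M : Fin K → ℕ
  /-- power allocation ratios -/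
  phi : Fin K → ℝ
  /-- density of the eavesdroppers -/
  lamE : ℝ
  /-- noise power -/
  N0 : ℝ
  two_lt_alpha : 2 < alpha
  lam_pos : ∀ j, 0 < lam j
  pow_pos : ∀ j, 0 < pow j
  two_le_M : ∀ j, 2 ≤ M j
  phi_pos : ∀ j, 0 < phi j
  phi_le_one : ∀ j, phi j ≤ 1
  lamE_pos : 0 < lamE
  N0_nonneg : 0 ≤ N0

/-- Marks of an interfering base station with `M` antennas: whether it is active, the channel to
the user it serves, and the channels to the eavesdroppers. -/
abbrev BSMark (M : ℕ) : Type := Bool × (Fin M → ℂ) × (ℕ → Fin M → ℂ)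

/-- Marks of the serving base station: the channels to its user and to the eavesdroppers. -/
abbrev ServingMark (M : ℕ) : Type := (Fin M → ℂ) × (ℕ → Fin M → ℂ)

/-- Law of the marks of the serving base station: all channels independent. -/
def servingLaw (M : ℕ) : Measure (ServingMark M) :=
  (channelLaw M).prod (Measure.infinitePi fun _ : ℕ => channelLaw M)

instance (M : ℕ) : IsProbabilityMeasure (servingLaw M) := by
  unfold servingLaw; infer_instance

/-- Law of the marks of an interfering base station: active with probability `a`, independently
of its channels. -/
def bsLaw (a : unitInterval) (M : ℕ) : Measure (BSMark M) :=
  (bernoulliMeasure true false a).prod (servingLaw M)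

instance (a : unitInterval) (M : ℕ) : IsProbabilityMeasure (bsLaw a M) := by
  unfold bsLaw; infer_instance

/-- A realisation, on a probability space `(Ω, P)`, of the network seen from a base station of
tier `k` that serves the typical user. A base station of tier `j` is active with probability
`A j`. -/
structure Deployment {K : ℕ} (net : Network K) (A : Fin K → unitInterval) (k : Fin K)
    {Ω : Type*} [MeasurableSpace Ω] (P : Measure Ω) where
  /-- location of the serving base station -/
  b : Plane
  /-- locations of the other base stations of each tier -/
  bs : Fin K → ℕ → Ω → Plane
  /-- locations of the eavesdroppers -/
  eve : ℕ → Ω → Plane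
  /-- marks of the other base stations -/
  mark : ∀ j, ℕ → Ω → BSMark (net.M j)
  /-- marks of the serving base station -/
  serving : Ω → ServingMark (net.M k)
  /-- artificial-noise weight matrices -/
  precoder : ∀ j, NoisePrecoder (net.M j)
  bs_poisson : ∀ j, IsPoissonProcess P (net.lam j) (bs j)
  eve_poisson : IsPoissonProcess P net.lamE eve
  /-- the point processes of all tiers and of the eavesdroppers are independent -/
  points_indep : iIndepFun
    (fun (o : Option (Fin K)) ω (n : ℕ) => o.elim (eve n ω) fun j => bs j n ω) P
  mark_measurable : ∀ j n, Measurable (mark j n)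
  serving_measurable : Measurable serving
  /-- all marks are independent of one another, with the prescribed laws -/
  marks_law : HasLaw
    (fun ω => ((fun j n => mark j n ω : ∀ j, ℕ → BSMark (net.M j)), serving ω))
    ((Measure.pi fun j => Measure.infinitePi fun _ : ℕ => bsLaw (A j) (net.M j)).prod
      (servingLaw (net.M k))) P
  /-- the marks are independent of the locations -/
  marks_indep : IndepFun (fun ω => ((fun j n => bs j n ω : Fin K → ℕ → Plane), fun n => eve n ω))
    (fun ω => ((fun j n => mark j n ω : ∀ j, ℕ → BSMark (net.M j)), serving ω)) P

namespace Deployment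

variable {K : ℕ} {net : Network K} {A : Fin K → unitInterval} {k : Fin K}
  {Ω : Type*} [MeasurableSpace Ω] {P : Measure Ω}

/-- Power received by eavesdropper `i` from the information signal of the serving base station. -/
def signal (D : Deployment net A k P) (i : ℕ) (ω : Ω) : ℝ :=
  net.phi k * net.pow k * signalGain (D.serving ω).1 ((D.serving ω).2 i)
    / dist D.b (D.eve i ω) ^ net.alpha

/-- Power received by eavesdropper `i` from the artificial noise of the serving base station. -/
def servingNoise (D : Deployment net A k P) (i : ℕ) (ω : Ω) : ℝ :=
  (1 - net.phi k) * net.pow k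
    * noiseGain (D.precoder k) (D.serving ω).1 ((D.serving ω).2 i)
    / (((net.M k : ℝ) - 1) * dist D.b (D.eve i ω) ^ net.alpha)

/-- Power received by eavesdropper `i` from the artificial noise of the `n`-th base station of
tier `j`, which is zero if that base station is idle. -/
def otherNoise (D : Deployment net A k P) (j : Fin K) (n i : ℕ) (ω : Ω) : ℝ :=
  if (D.mark j n ω).1 then
    (1 - net.phi j) * net.pow j
      * noiseGain (D.precoder j) (D.mark j n ω).2.1 ((D.mark j n ω).2.2 i)
      / (((net.M j : ℝ) - 1) * dist (D.bs j n ω) (D.eve i ω) ^ net.alpha)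
  else 0

/-- The signal-to-interference-plus-noise ratio of eavesdropper `i`. The aggregate artificial
noise is a sum of nonnegative terms, taken in `[0, ∞]`. -/
def sinr (D : Deployment net A k P) (i : ℕ) (ω : Ω) : ℝ≥0∞ :=
  ENNReal.ofReal (D.signal i ω) /
    (ENNReal.ofReal (D.servingNoise i ω)
      + ∑ j, ∑' n, ENNReal.ofReal (D.otherNoise j n i ω)
      + ENNReal.ofReal net.N0)

/-- The σ-algebra generated by the locations of all base stations and eavesdroppers. -/
abbrev locations (D : Deployment net A k P) : MeasurableSpace Ω :=
  MeasurableSpace.comap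
    (fun ω => ((fun j n => D.bs j n ω : Fin K → ℕ → Plane), fun n => D.eve n ω)) inferInstance

/-- The secrecy probability of tier `k`: the expectation over all locations of the product over
all eavesdroppers of the conditional probability, given the locations, that the eavesdropper's
SINR is below `βe`. -/
def secrecyProb (D : Deployment net A k P) (βe : ℝ) : ℝ :=
  ∫ ω, ∏' i : ℕ, (P⟦{ω' | D.sinr i ω' < ENNReal.ofReal βe} | D.locations⟧) ω ∂P

end Deployment

/-! ### The bounds -/

namespace Network

variable {K : ℕ} (net : Network K)

/-- `δ = 2 / α` -/
def delta : ℝ := 2 / net.alpha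

/-- `ξ_j = (φ_j⁻¹ - 1) / (M_j - 1)` -/
def xi (j : Fin K) : ℝ := ((net.phi j)⁻¹ - 1) / ((net.M j : ℝ) - 1)

/-- `C_{α,m} = Γ(m - 1 + 2/α) Γ(1 - 2/α) / Γ(m - 1)` -/
def gammaConst (m : ℕ) : ℝ :=
  Real.Gamma ((m : ℝ) - 1 + 2 / net.alpha) * Real.Gamma (1 - 2 / net.alpha)
    / Real.Gamma ((m : ℝ) - 1)

/-- `ψ_k = ∑_j A_j λ_j C_{α,M_j} (ξ_j (φ_j / φ_k) (P_j / P_k)) ^ δ` -/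
def psi (A : Fin K → unitInterval) (k : Fin K) : ℝ :=
  ∑ j, (A j : ℝ) * net.lam j * net.gammaConst (net.M j)
    * (net.xi j * (net.phi j / net.phi k) * (net.pow j / net.pow k)) ^ net.delta

/-- The lower bound on the secrecy probability in integral form. -/
def lowerIntegral (A : Fin K → unitInterval) (k : Fin K) (βe : ℝ) : ℝ :=
  Real.exp (-(Real.pi * net.lamE / (1 + net.xi k * βe) ^ (net.M k - 1)
    * ∫ r in Set.Ioi (0 : ℝ),
        Real.exp (-(βe * net.N0 / (net.phi k * net.pow k)) * r ^ (net.alpha / 2)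
          - Real.pi * net.psi A k * βe ^ net.delta * r)))

/-- The upper bound on the secrecy probability in integral form. -/
def upperIntegral (A : Fin K → unitInterval) (k : Fin K) (βe : ℝ) : ℝ :=
  1 - Real.pi * net.lamE / (1 + net.xi k * βe) ^ (net.M k - 1)
    * ∫ r in Set.Ioi (0 : ℝ),
        Real.exp (-(βe * net.N0 / (net.phi k * net.pow k)) * r ^ (net.alpha / 2)
          - Real.pi * net.psi A k * βe ^ net.delta * r - Real.pi * net.lamE * r)

/-- `γ_k = 4 β_e N_0 / (π² φ_k P_k)` -/
def gam (k : Fin K) (βe : ℝ) : ℝ :=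
  4 * βe * net.N0 / (Real.pi ^ 2 * net.phi k * net.pow k)

end Network

/-- `Ω(x) = π^(-1/2) ∫₀^{x²} e^{-t} t^{-1/2} dt` -/
def Omega (x : ℝ) : ℝ :=
  1 / Real.sqrt Real.pi * ∫ t in (0 : ℝ)..x ^ 2, Real.exp (-t) / Real.sqrt t

namespace Network

variable {K : ℕ} (net : Network K)

/-- The closed form of the lower bound for path-loss exponent `4`. -/
def lowerClosed (A : Fin K → unitInterval) (k : Fin K) (βe : ℝ) : ℝ :=
  Real.exp (-(Real.sqrt Real.pi * net.lamE
      * Real.exp (net.psi A k ^ 2 * βe ^ (2 * net.delta) / net.gam k βe)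
      / (Real.sqrt (net.gam k βe) * (1 + net.xi k * βe) ^ (net.M k - 1))
    * (1 - Omega (net.psi A k * βe ^ net.delta / Real.sqrt (net.gam k βe)))))

/-- The closed form of the upper bound for path-loss exponent `4`. -/
def upperClosed (A : Fin K → unitInterval) (k : Fin K) (βe : ℝ) : ℝ :=
  1 - Real.sqrt Real.pi * net.lamE
      * Real.exp ((net.lamE + net.psi A k * βe ^ net.delta) ^ 2 / net.gam k βe)
      / (Real.sqrt (net.gam k βe) * (1 + net.xi k * βe) ^ (net.M k - 1))
    * (1 - Omega ((net.lamE + net.psi A k * βe ^ net.delta) / Real.sqrt (net.gam k βe)))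

end Network

end

end SecrecyHCN

/-! Fix all locations. Projecting the Gaussian channel of an eavesdropper onto the orthonormal basis
`[w W]` leaves its law unchanged, so the signal gain is Exp(1) and the noise gain is an independent
Gamma variable of shape `M - 1` (`lintegral_gains`). The event SINR ≥ β says that an exponential
variable exceeds β times the total noise, suitably scaled. Its conditional probability is therefore
a Laplace transform and factors over the serving noise, the thermal noise and the interferers. This
gives an explicit interception probability `g(y) = outage` at each point `y ≠ b`
(`Network.lintegral_sinrAt_ge`), the same for every index of an eavesdropper.

The Laplace functional of the Poisson process of eavesdroppers, applied to `-log (1 - g)`, turns the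
mean of the product into `E exp(-λ_e ∫ g)`, where the remaining expectation is over the base
stations (`Deployment.secrecyProb_eq`). The Laplace functional of each tier gives the mean of
`g(y)`: the constant `(1 + ξβ)^{-(M-1)}` times the exponential of minus a noise term in `d^α` and an
interference term `πψβ^δ d²` (`Deployment.lintegral_outage`).

The lower bound is Jensen's inequality for `x ↦ e^{-x}`. The upper bound expresses that some
eavesdropper intercepts at least as often as the nearest one does: for `0 ≤ g ≤ 1`, `1 - exp(-λ_e ∫
g)` dominates the integral of `g` against the density of the nearest point (`lintegral_nearest_le`).
Here that is proved analytically, by a rearrangement argument. For `α = 4` both exponents are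
quadratic in `r = d²`, and completing the square produces the error function `Omega`.

Probabilities and interference take values in `[0, ∞]`, and infinite products are written as
`e^{-Σ}`. Every sum then converges, and divergent interference or a vanishing factor is simply the
value `∞` of the exponent. -/

namespace SecrecyHCN

noncomputable section

/-! ### The function `x ↦ e^{-x}` on `[0, ∞]` -/

/-- `e^{-x}` for `x ∈ [0, ∞]`, with `e^{-∞} = 0`. -/
def expNeg (x : ℝ≥0∞) : ℝ≥0∞ := EReal.exp (-(x : EReal))

lemma expNeg_zero : expNeg 0 = 1 := by simp [expNeg]

lemma expNeg_top : expNeg ∞ = 0 := by simp [expNeg]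

lemma expNeg_add (x y : ℝ≥0∞) : expNeg (x + y) = expNeg x * expNeg y := by
  rw [expNeg, EReal.coe_ennreal_add, EReal.neg_add, sub_eq_add_neg, EReal.exp_add]
  · rfl
  · left; simp
  · right; simp

lemma expNeg_le_one (x : ℝ≥0∞) : expNeg x ≤ 1 := by
  have : (0 : EReal) ≤ x := EReal.coe_ennreal_nonneg x
  simpa [expNeg] using this

lemma expNeg_ne_top (x : ℝ≥0∞) : expNeg x ≠ ∞ :=
  ((expNeg_le_one x).trans_lt ENNReal.one_lt_top).ne

lemma continuous_expNeg : Continuous expNeg :=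
  ENNReal.continuous_exp.comp (continuous_neg.comp continuous_coe_ennreal_ereal)

@[fun_prop]
lemma measurable_expNeg : Measurable expNeg := continuous_expNeg.measurable

lemma antitone_expNeg : Antitone expNeg := fun x y h => by
  simpa [expNeg] using h

lemma expNeg_ofReal {x : ℝ} (hx : 0 ≤ x) :
    expNeg (ENNReal.ofReal x) = ENNReal.ofReal (Real.exp (-x)) := by
  rw [expNeg, EReal.coe_ennreal_ofReal, max_eq_left hx, ← EReal.coe_neg, EReal.exp_coe]

lemma expNeg_sum {ι : Type*} (s : Finset ι) (f : ι → ℝ≥0∞) :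
    expNeg (∑ i ∈ s, f i) = ∏ i ∈ s, expNeg (f i) := by
  classical
  induction s using Finset.induction_on with
  | empty => simp [expNeg_zero]
  | insert i s hi ih => rw [Finset.sum_insert hi, Finset.prod_insert hi, expNeg_add, ih]

lemma expNeg_nsmul (x : ℝ≥0∞) (n : ℕ) : expNeg (x * n) = expNeg x ^ n := by
  have := expNeg_sum (Finset.range n) fun _ => x
  simpa [mul_comm] using this

/-- No summability is needed: partial sums in `[0, ∞]` always converge, and `expNeg` is continuous
at `∞` as well. -/
lemma tendsto_expNeg_tsum (f : ℕ → ℝ≥0∞) :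
    Filter.Tendsto (fun N => ∏ n ∈ Finset.range N, expNeg (f n)) Filter.atTop
      (nhds (expNeg (∑' n, f n))) := by
  simp_rw [← expNeg_sum]
  exact (continuous_expNeg.tendsto _).comp ENNReal.summable.hasSum.tendsto_sum_nat

/-- `-log u` for `u ∈ [0, 1]`, with `-log 0 = ∞`. -/
def negLog (u : ℝ≥0∞) : ℝ≥0∞ := (-ENNReal.log u).toENNReal

@[fun_prop]
lemma measurable_negLog : Measurable negLog := by
  unfold negLog
  exact (ENNReal.measurable_log.neg).ereal_toENNReal

/-- The bound `u ≤ 1` makes `-log u` nonnegative, so that `toENNReal` truncates nothing. -/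
lemma expNeg_negLog {u : ℝ≥0∞} (hu : u ≤ 1) : expNeg (negLog u) = u := by
  have : 0 ≤ -ENNReal.log u := by
    simpa using hu
  rw [expNeg, negLog, EReal.coe_toENNReal this, neg_neg, ENNReal.exp_log]

/-! ### The Laplace functional of a Poisson process -/

/-- This is the Poisson generating function `E q^N = e^{-r(1-q)}` at `q = e^{-c}`; the value `c = ∞`
corresponds to `q = 0`. -/
lemma lintegral_poissonMeasure_expNeg (r : ℝ≥0) (c : ℝ≥0∞) :
    ∫⁻ n : ℕ, expNeg (c * n) ∂(poissonMeasure r) = expNeg (r * (1 - expNeg c)) := by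
  obtain ⟨q, hq⟩ : ∃ q : ℝ≥0, expNeg c = q := ⟨(expNeg c).toNNReal, by
    rw [ENNReal.coe_toNNReal (expNeg_ne_top c)]⟩
  have hq1 : q ≤ 1 := by
    have := expNeg_le_one c
    rw [hq] at this
    exact_mod_cast this
  have hrhs : expNeg (r * (1 - expNeg c)) = ENNReal.ofReal (Real.exp (-(r * (1 - q)))) := by
    have h0 : (0 : ℝ) ≤ r * (1 - q) := mul_nonneg r.2 (sub_nonneg.2 (by exact_mod_cast hq1))
    rw [← expNeg_ofReal h0, hq]
    congr 1
    rw [ENNReal.ofReal_mul NNReal.zero_le_coe, ENNReal.ofReal_sub _ NNReal.zero_le_coe]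
    simp
  rw [hrhs, lintegral_countable']
  have h1 : ∀ n : ℕ, expNeg (c * n) * poissonMeasure r {n}
      = ENNReal.ofReal (Real.exp (-r) * ((r * q : ℝ) ^ n / n.factorial)) := by
    intro n
    rw [expNeg_nsmul, hq, poissonMeasure_singleton, ← ENNReal.ofReal_coe_nnreal,
      ← ENNReal.ofReal_pow (by positivity), ← ENNReal.ofReal_mul (by positivity)]
    congr 1
    rw [mul_pow]; ring
  simp_rw [h1]
  have h2 : HasSum (fun n : ℕ => Real.exp (-r) * ((r * q : ℝ) ^ n / n.factorial))
      (Real.exp (-r) * Real.exp (r * q)) := by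
    have := NormedSpace.expSeries_div_hasSum_exp (r * q : ℝ)
    rw [← Real.exp_eq_exp_ℝ] at this
    exact this.mul_left _
  rw [← ENNReal.ofReal_tsum_of_nonneg (fun n => by positivity) h2.summable, h2.tsum_eq,
    ← Real.exp_add]
  congr 2; ring

lemma lintegral_pointCount {Ω : Type*} (X : ℕ → Ω → Plane) (ω : Ω) {f : Plane → ℝ≥0∞}
    (hf : Measurable f) : ∫⁻ x, f x ∂(pointCount X ω) = ∑' n, f (X n ω) := by
  simp [pointCount, lintegral_sum_measure, lintegral_dirac' _ hf]

namespace IsPoissonProcess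

variable {Ω : Type*} [MeasurableSpace Ω] {P : Measure Ω} {lam : ℝ} {X : ℕ → Ω → Plane}

lemma measurable_pointCount (hX : IsPoissonProcess P lam X) {B : Set Plane}
    (hB : MeasurableSet B) : Measurable fun ω => pointCount X ω B := by
  have : (fun ω => pointCount X ω B) = fun ω => ∑' n, B.indicator 1 (X n ω) := by
    ext ω
    rw [← lintegral_pointCount X ω (measurable_one.indicator hB), lintegral_indicator_one hB]
  rw [this]
  exact Measurable.tsum fun n => (measurable_one.indicator hB).comp (hX.measurable n)

lemma lintegral_expNeg_pointCount (hX : IsPoissonProcess P lam X) {B : Set Plane}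
    (hB : MeasurableSet B) (hfin : volume B ≠ ∞) (c : ℝ≥0∞) :
    ∫⁻ ω, expNeg (c * pointCount X ω B) ∂P
      = expNeg (ENNReal.ofReal lam * ((1 - expNeg c) * volume B)) := by
  have h := (hX.count_law B hB hfin).lintegral_comp
    (f := fun x => expNeg (c * x)) (by fun_prop)
  rw [h, lintegral_map (by fun_prop) (by fun_prop), lintegral_poissonMeasure_expNeg]
  congr 1
  rw [ENNReal.coe_mul, ENNReal.coe_toNNReal hfin, mul_assoc, mul_comm (volume B)]
  rfl

/-- The level sets of `g` are disjoint, so their counts are independent Poisson variables and the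
expectation factors over the values of `g`. -/
lemma laplace_simpleFunc (hX : IsPoissonProcess P lam X) (g : SimpleFunc Plane ℝ≥0∞)
    (hg : ∀ y ≠ 0, volume (g ⁻¹' {y}) ≠ ∞) :
    ∫⁻ ω, expNeg (∫⁻ x, g x ∂(pointCount X ω)) ∂P
      = expNeg (ENNReal.ofReal lam * ∫⁻ x, (1 - expNeg (g x))) := by
  classical
  -- The value `0` is discarded: its level set may have infinite area, but it contributes nothing to
  -- either side.
  set s := g.range.filter (· ≠ 0) with hs
  have hind : iIndepFun (fun (i : Fin s.card) ω =>
      pointCount X ω (g ⁻¹' {(s.equivFin.symm i : ℝ≥0∞)})) P := by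
    refine hX.count_indep _ _ (fun i => g.measurableSet_fiber _) (fun i => hg _ ?_) ?_
    · exact (Finset.mem_filter.1 (s.equivFin.symm i).2).2
    · intro i j hij
      refine Disjoint.preimage _ (Set.disjoint_singleton.2 fun h => hij ?_)
      exact s.equivFin.symm.injective (Subtype.ext h)
  have hl : ∀ ω, expNeg (∫⁻ x, g x ∂(pointCount X ω))
      = ∏ i : Fin s.card, expNeg ((s.equivFin.symm i : ℝ≥0∞)
          * pointCount X ω (g ⁻¹' {(s.equivFin.symm i : ℝ≥0∞)})) := by
    intro ω
    rw [← expNeg_sum, s.equivFin.symm.sum_comp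
      (fun y : s => (y : ℝ≥0∞) * pointCount X ω (g ⁻¹' {(y : ℝ≥0∞)})),
      Finset.sum_coe_sort s (fun y : ℝ≥0∞ => y * pointCount X ω (g ⁻¹' {y})),
      SimpleFunc.lintegral_eq_lintegral, SimpleFunc.lintegral, hs, Finset.sum_filter]
    congr 1
    refine Finset.sum_congr rfl fun y _ => ?_
    split_ifs with h
    · rfl
    · simp [not_not.1 h]
  have hr : ∫⁻ x, (1 - expNeg (g x)) = ∑ y ∈ s, (1 - expNeg y) * volume (g ⁻¹' {y}) := by
    have : ∫⁻ x, (1 - expNeg (g x)) = (g.map fun y => 1 - expNeg y).lintegral volume := by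
      rw [← SimpleFunc.lintegral_eq_lintegral]; rfl
    rw [this, SimpleFunc.map_lintegral, hs, Finset.sum_filter]
    refine Finset.sum_congr rfl fun y _ => ?_
    split_ifs with h
    · rfl
    · simp [not_not.1 h, expNeg_zero]
  simp_rw [hl]
  have hind' : iIndepFun (fun (i : Fin s.card) ω => expNeg ((s.equivFin.symm i : ℝ≥0∞)
      * pointCount X ω (g ⁻¹' {(s.equivFin.symm i : ℝ≥0∞)}))) P :=
    hind.comp (fun i x => expNeg ((s.equivFin.symm i : ℝ≥0∞) * x)) (fun i => by fun_prop)
  have hmeas : ∀ y : ℝ≥0∞, Measurable fun ω => pointCount X ω (g ⁻¹' {y}) := fun y =>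
    hX.measurable_pointCount (g.measurableSet_fiber _)
  rw [lintegral_prod_eq_prod_lintegral_of_indepFun _ _ hind' (fun i => by fun_prop), hr,
    Finset.mul_sum, expNeg_sum, ← Finset.prod_coe_sort s, ← s.equivFin.symm.prod_comp]
  refine Finset.prod_congr rfl fun i _ => ?_
  exact hX.lintegral_expNeg_pointCount (g.measurableSet_fiber _)
    (hg _ (Finset.mem_filter.1 (s.equivFin.symm i).2).2) _

/-- The Laplace functional of a Poisson process. -/
theorem laplace [IsFiniteMeasure P] (hX : IsPoissonProcess P lam X) {f : Plane → ℝ≥0∞}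
    (hf : Measurable f) :
    ∫⁻ ω, expNeg (∑' n, f (X n ω)) ∂P
      = expNeg (ENNReal.ofReal lam * ∫⁻ x, (1 - expNeg (f x))) := by
  set S := spanningSets (volume : Measure Plane) with hS
  -- Cutting off to sets of finite area makes every level set of a nonzero value finite in area
  -- while keeping the sequence increasing to `f`.
  set g : ℕ → SimpleFunc Plane ℝ≥0∞ := fun n => (SimpleFunc.eapprox f n).restrict (S n) with hgdef
  have hSm : ∀ n, MeasurableSet (S n) := fun n => measurableSet_spanningSets _ n
  have hgx : ∀ n x, g n x = (S n).indicator (SimpleFunc.eapprox f n) x := fun n x => by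
    rw [hgdef]; simp only; rw [SimpleFunc.restrict_apply _ (hSm n)]
  have hmono : ∀ x, Monotone fun n => g n x := by
    intro x m n hmn
    simp only [hgx]
    exact Set.indicator_le_indicator_of_subset (monotone_spanningSets _ hmn) (fun _ => zero_le) x
      |>.trans (Set.indicator_le_indicator (SimpleFunc.monotone_eapprox f hmn x))
  have hsup : ∀ x, ⨆ n, g n x = f x := by
    intro x
    apply le_antisymm
    · refine iSup_le fun n => ?_
      rw [hgx, ← SimpleFunc.iSup_eapprox_apply hf x]
      exact (Set.indicator_le_self _ _ _).trans (le_iSup (fun n => SimpleFunc.eapprox f n x) n)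
    · rw [← SimpleFunc.iSup_eapprox_apply hf x]
      refine iSup_le fun n => ?_
      obtain ⟨m, hm⟩ : ∃ m, x ∈ S m := by
        have : x ∈ ⋃ i, S i := by rw [iUnion_spanningSets]; trivial
        simpa using this
      refine le_trans ?_ (le_iSup _ (max n m))
      rw [hgx, Set.indicator_of_mem (monotone_spanningSets _ (le_max_right n m) hm)]
      exact SimpleFunc.monotone_eapprox f (le_max_left n m) x
  have hfin : ∀ n, ∀ y ≠ 0, volume ((g n) ⁻¹' {y}) ≠ ∞ := by
    intro n y hy
    refine ((measure_mono ?_).trans_lt (measure_spanningSets_lt_top volume n)).ne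
    intro x hx
    by_contra hxS
    apply hy
    have : g n x = y := hx
    rw [← this, hgx, Set.indicator_of_notMem hxS]
  have hlim : ∀ μ : Measure Plane, Filter.Tendsto (fun n => ∫⁻ x, g n x ∂μ) Filter.atTop
      (nhds (∫⁻ x, f x ∂μ)) := by
    intro μ
    simp_rw [← hsup]
    rw [lintegral_iSup (fun n => (g n).measurable) (fun m n h x => hmono x h)]
    exact tendsto_atTop_iSup fun m n h => lintegral_mono fun x => hmono x h
  have h1 : Filter.Tendsto (fun n => ∫⁻ ω, expNeg (∫⁻ x, g n x ∂(pointCount X ω)) ∂P)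
      Filter.atTop (nhds (∫⁻ ω, expNeg (∫⁻ x, f x ∂(pointCount X ω)) ∂P)) := by
    refine tendsto_lintegral_of_dominated_convergence (fun _ => 1) (fun n => ?_)
      (fun n => Filter.Eventually.of_forall fun ω => expNeg_le_one _) (by simp)
      (Filter.Eventually.of_forall fun ω => (continuous_expNeg.tendsto _).comp (hlim _))
    simp_rw [lintegral_pointCount X _ (g n).measurable]
    exact measurable_expNeg.comp (Measurable.tsum fun i =>
      (g n).measurable.comp (hX.measurable i))
  have h2 : Filter.Tendsto (fun n => ∫⁻ x, (1 - expNeg (g n x))) Filter.atTop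
      (nhds (∫⁻ x, (1 - expNeg (f x)))) := by
    refine lintegral_tendsto_of_tendsto_of_monotone (fun n => ?_)
      (Filter.Eventually.of_forall fun x m n h => ?_) (Filter.Eventually.of_forall fun x => ?_)
    · exact (measurable_const.sub (measurable_expNeg.comp (g n).measurable)).aemeasurable
    · exact tsub_le_tsub_left (antitone_expNeg (hmono x h)) 1
    · have : Filter.Tendsto (fun n => g n x) Filter.atTop (nhds (f x)) := by
        rw [← hsup]; exact tendsto_atTop_iSup (hmono x)
      exact ENNReal.Tendsto.sub tendsto_const_nhds ((continuous_expNeg.tendsto _).comp this)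
        (Or.inl ENNReal.one_ne_top)
  have h3 : Filter.Tendsto
      (fun n => expNeg (ENNReal.ofReal lam * ∫⁻ x, (1 - expNeg (g n x)))) Filter.atTop
      (nhds (expNeg (ENNReal.ofReal lam * ∫⁻ x, (1 - expNeg (f x))))) :=
    (continuous_expNeg.tendsto _).comp
      (ENNReal.Tendsto.const_mul h2 (Or.inr ENNReal.ofReal_ne_top))
  simp_rw [← lintegral_pointCount X _ hf]
  refine tendsto_nhds_unique h1 (h3.congr fun n => ?_)
  exact (hX.laplace_simpleFunc (g n) (hfin n)).symm

end IsPoissonProcess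

/-! ### Unitary invariance of Rayleigh fading -/

/-- Real and imaginary parts are independent of variance `1/2`, so the Gaussian exponent is
`(1/2)(1/2)‖a‖²`. -/
lemma integral_cexp_complexGaussian (a : ℂ) :
    ∫ z, Complex.exp (((z * star a).re : ℂ) * Complex.I) ∂complexGaussian
      = Complex.exp (-(‖a‖ ^ 2 / 4 : ℝ)) := by
  rw [complexGaussian, integral_map (by fun_prop) (by fun_prop)]
  have h : ∀ p : ℝ × ℝ,
      Complex.exp (((((p.1 : ℂ) + (p.2 : ℂ) * Complex.I) * star a).re : ℂ) * Complex.I)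
      = Complex.exp (a.re * p.1 * Complex.I) * Complex.exp (a.im * p.2 * Complex.I) := by
    intro p
    rw [← Complex.exp_add]
    congr 1
    have : (((p.1 : ℂ) + (p.2 : ℂ) * Complex.I) * star a).re = a.re * p.1 + a.im * p.2 := by
      simp; ring
    rw [this]; push_cast; ring
  simp_rw [h]
  rw [integral_prod_mul (fun x : ℝ => Complex.exp (a.re * x * Complex.I))
    (fun y : ℝ => Complex.exp (a.im * y * Complex.I)),
    ← charFun_apply_real, ← charFun_apply_real, charFun_gaussianReal, charFun_gaussianReal,
    ← Complex.exp_add]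
  congr 1
  rw [← Complex.normSq_eq_norm_sq, Complex.normSq_apply]
  push_cast; ring

/-- The value depends on `w` only through its Euclidean norm, which is the source of unitary
invariance. -/
lemma integral_cexp_channelLaw {M : ℕ} (w : Fin M → ℂ) :
    ∫ g, Complex.exp (((g ⬝ᵥ star w).re : ℂ) * Complex.I) ∂(channelLaw M)
      = Complex.exp (-((∑ i, ‖w i‖ ^ 2) / 4 : ℝ)) := by
  have h : ∀ g : Fin M → ℂ, Complex.exp (((g ⬝ᵥ star w).re : ℂ) * Complex.I)
      = ∏ i, Complex.exp (((g i * star (w i)).re : ℂ) * Complex.I) := by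
    intro g
    rw [← Complex.exp_sum, dotProduct, Complex.re_sum, Complex.ofReal_sum, Finset.sum_mul]
    rfl
  simp_rw [h, channelLaw]
  rw [integral_fintype_prod_eq_prod
    (f := fun (i : Fin M) (z : ℂ) => Complex.exp (((z * star (w i)).re : ℂ) * Complex.I))]
  simp_rw [integral_cexp_complexGaussian]
  rw [← Complex.exp_sum, Finset.sum_neg_distrib, Finset.sum_div]
  push_cast
  rfl

lemma sum_norm_sq_mulVec {M : ℕ} {U : Matrix (Fin M) (Fin M) ℂ} (hU : Uᴴ * U = 1)
    (v : Fin M → ℂ) : ∑ i, ‖(U *ᵥ v) i‖ ^ 2 = ∑ i, ‖v i‖ ^ 2 := by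
  have key : ∀ u : Fin M → ℂ, ((∑ i, ‖u i‖ ^ 2 : ℝ) : ℂ) = star u ⬝ᵥ u := by
    intro u
    rw [dotProduct, Complex.ofReal_sum]
    refine Finset.sum_congr rfl fun i _ => ?_
    rw [Pi.star_apply, Complex.star_def, Complex.conj_mul']
    push_cast; rfl
  apply Complex.ofReal_injective
  rw [key, key, Matrix.star_mulVec, ← Matrix.dotProduct_mulVec, Matrix.mulVec_mulVec, hU,
    Matrix.one_mulVec]

/-- A finite measure is determined by its characteristic function. Multiplication by `U` moves to
the test vector, whose norm it preserves. -/
lemma channelLaw_map_vecMul {M : ℕ} {U : Matrix (Fin M) (Fin M) ℂ} (hU : Uᴴ * U = 1) :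
    (channelLaw M).map (fun g => g ᵥ* U) = channelLaw M := by
  have hcont : Continuous fun g : Fin M → ℂ => g ᵥ* U := by fun_prop
  have : IsProbabilityMeasure ((channelLaw M).map (fun g => g ᵥ* U)) :=
    Measure.isProbabilityMeasure_map hcont.measurable.aemeasurable
  -- The real inner product on `ℂ ^ M`; it separates points because pairing `v` with itself gives `Σ
  -- ‖v i‖²`.
  let L : (Fin M → ℂ) →ₗ[ℝ] (Fin M → ℂ) →ₗ[ℝ] ℝ :=
    LinearMap.mk₂ ℝ (fun v w => (v ⬝ᵥ star w).re)
      (fun v v' w => by simp [add_dotProduct]) (fun c v w => by simp [smul_dotProduct])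
      (fun v w w' => by simp [dotProduct_add]) (fun c v w => by simp [dotProduct_smul])
  have hL : Continuous fun p : (Fin M → ℂ) × (Fin M → ℂ) => L p.1 p.2 := by
    change Continuous fun p : (Fin M → ℂ) × (Fin M → ℂ) => (p.1 ⬝ᵥ star p.2).re
    fun_prop
  refine ext_of_integral_char_eq Real.continuous_probChar
    Real.probChar_ne_one (L := L) (fun v hv h => hv ?_) hL fun w => ?_
  · have h0 : (v ⬝ᵥ star v).re = 0 := by
      have := congrArg (fun f => f v) h
      exact this
    rw [dotProduct, Complex.re_sum] at h0
    have h1 : ∀ i, (v i * star v i).re = ‖v i‖ ^ 2 := by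
      intro i
      rw [Pi.star_apply, Complex.star_def, Complex.mul_conj', ← Complex.ofReal_pow,
        Complex.ofReal_re]
    simp_rw [h1] at h0
    rw [Finset.sum_eq_zero_iff_of_nonneg fun i _ => by positivity] at h0
    ext i
    simpa using h0 i (Finset.mem_univ _)
  · have hc : ∀ v w : Fin M → ℂ, BoundedContinuousFunction.char
        Real.continuous_probChar hL w v
        = Complex.exp (((v ⬝ᵥ star w).re : ℂ) * Complex.I) := by
      intro v w
      rw [BoundedContinuousFunction.char_apply]
      simp [L, Real.probChar_apply, mul_comm]
    rw [integral_map hcont.measurable.aemeasurable (by fun_prop)]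
    simp_rw [hc]
    rw [integral_cexp_channelLaw]
    have h2 : ∀ g : Fin M → ℂ, (g ᵥ* U) ⬝ᵥ star w = g ⬝ᵥ star (star (U *ᵥ star w)) := by
      intro g
      rw [star_star, Matrix.dotProduct_mulVec]
    simp_rw [h2]
    rw [integral_cexp_channelLaw]
    simp only [Pi.star_apply, norm_star]
    rw [sum_norm_sq_mulVec hU]
    simp

/-! ### Radial integrals in the plane -/

lemma lintegral_two_mul_comp_sq (F : ℝ → ℝ≥0∞) :
    ∫⁻ r in Set.Ioi (0 : ℝ), ENNReal.ofReal (2 * r) * F (r ^ 2) = ∫⁻ t in Set.Ioi (0 : ℝ), F t := by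
  have himg : (fun r : ℝ => r ^ 2) '' Set.Ioi 0 = Set.Ioi 0 := by
    ext t
    constructor
    · rintro ⟨r, hr, rfl⟩
      exact pow_pos (Set.mem_Ioi.1 hr) 2
    · intro ht
      exact ⟨Real.sqrt t, Real.sqrt_pos.2 ht, Real.sq_sqrt (le_of_lt ht)⟩
  conv_rhs => rw [← himg]
  rw [lintegral_image_eq_lintegral_abs_deriv_mul (f' := fun r => 2 * r) measurableSet_Ioi
    (fun x _ => by simpa using (hasDerivAt_pow 2 x).hasDerivWithinAt)
    (fun x hx y hy h => (pow_left_inj₀ (le_of_lt hx) (le_of_lt hy) two_ne_zero).1 h)]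
  refine setLIntegral_congr_fun measurableSet_Ioi fun r hr => ?_
  have : 0 < r := hr
  simp only [abs_of_pos (mul_pos two_pos this)]

/-- With the squared radius `t` as variable the area element becomes `π dt`, so no Jacobian is left
in later radial integrals. -/
lemma lintegral_radial_prod {F : ℝ → ℝ≥0∞} (hF : Measurable F) :
    ∫⁻ p : ℝ × ℝ, F (p.1 ^ 2 + p.2 ^ 2)
      = ENNReal.ofReal Real.pi * ∫⁻ t in Set.Ioi (0 : ℝ), F t := by
  rw [← lintegral_comp_polarCoord_symm]
  have h1 : ∀ p : ℝ × ℝ, ENNReal.ofReal p.1 • F ((polarCoord.symm p).1 ^ 2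
      + (polarCoord.symm p).2 ^ 2) = ENNReal.ofReal p.1 * F (p.1 ^ 2) := by
    intro p
    rw [polarCoord_symm_apply, smul_eq_mul]
    congr 2
    have := Real.sin_sq_add_cos_sq p.2
    linear_combination p.1 ^ 2 * this
  simp_rw [h1]
  rw [polarCoord_target, Measure.volume_eq_prod, ← Measure.prod_restrict,
    lintegral_prod _ (by fun_prop)]
  simp only [lintegral_const, Measure.restrict_apply_univ, Real.volume_Ioo]
  rw [lintegral_mul_const _ (by fun_prop), ← lintegral_two_mul_comp_sq F]
  have h2 : ∀ r : ℝ, ENNReal.ofReal (2 * r) * F (r ^ 2) = 2 * (ENNReal.ofReal r * F (r ^ 2)) := by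
    intro r
    rw [ENNReal.ofReal_mul two_pos.le, mul_assoc]; simp
  simp_rw [h2]
  rw [lintegral_const_mul _ (by fun_prop), ← mul_assoc, mul_comm]
  congr 1
  rw [sub_neg_eq_add, ← mul_two, ENNReal.ofReal_mul Real.pi_pos.le]
  simp

/-! ### The laws of the gains -/

/-- The density `π⁻¹ e^{-|z|²}` is radial, and `π⁻¹` cancels against the area element `π dt`: the
squared modulus is Exp(1). -/
lemma lintegral_norm_sq_complexGaussian {F : ℝ → ℝ≥0∞} (hF : Measurable F) :
    ∫⁻ z, F (‖z‖ ^ 2) ∂complexGaussian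
      = ∫⁻ t in Set.Ioi (0 : ℝ), F t * ENNReal.ofReal (Real.exp (-t)) := by
  have hv : ((1 / 2 : ℝ≥0) : ℝ≥0) ≠ 0 := by norm_num
  rw [complexGaussian, lintegral_map (by fun_prop) (by fun_prop),
    gaussianReal_of_var_ne_zero _ hv, prod_withDensity (by fun_prop) (by fun_prop),
    lintegral_withDensity_eq_lintegral_mul _ (by fun_prop) (by fun_prop),
    ← Measure.volume_eq_prod]
  have h : ∀ p : ℝ × ℝ, ((fun z : ℝ × ℝ => gaussianPDF 0 (1 / 2) z.1 * gaussianPDF 0 (1 / 2) z.2)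
      * fun p : ℝ × ℝ => F (‖(p.1 : ℂ) + (p.2 : ℂ) * Complex.I‖ ^ 2)) p
      = (fun t => ENNReal.ofReal (Real.pi⁻¹) * (F t * ENNReal.ofReal (Real.exp (-t))))
        (p.1 ^ 2 + p.2 ^ 2) := by
    intro p
    have hn : ‖(p.1 : ℂ) + (p.2 : ℂ) * Complex.I‖ ^ 2 = p.1 ^ 2 + p.2 ^ 2 := by
      rw [← Complex.normSq_eq_norm_sq, Complex.normSq_add_mul_I]
    simp only [Pi.mul_apply, hn, gaussianPDF, gaussianPDFReal]
    rw [← ENNReal.ofReal_mul (by positivity), mul_comm (F _), ← mul_assoc (ENNReal.ofReal _),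
      ← ENNReal.ofReal_mul (by positivity)]
    congr 2
    have e1 : (2 * Real.pi * ((1 / 2 : ℝ≥0) : ℝ)) = Real.pi := by push_cast; ring
    have e2 : (2 * ((1 / 2 : ℝ≥0) : ℝ)) = 1 := by push_cast; ring
    rw [e1, e2, neg_add, Real.exp_add]
    have : (Real.sqrt Real.pi)⁻¹ * (Real.sqrt Real.pi)⁻¹ = Real.pi⁻¹ := by
      rw [← mul_inv, Real.mul_self_sqrt Real.pi_pos.le]
    rw [← this]; simp; ring
  rw [lintegral_congr h, lintegral_radial_prod
    (F := fun t => ENNReal.ofReal (Real.pi⁻¹) * (F t * ENNReal.ofReal (Real.exp (-t))))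
    (by fun_prop), lintegral_const_mul _ (by fun_prop), ← mul_assoc,
    ← ENNReal.ofReal_mul Real.pi_pos.le, mul_inv_cancel₀ Real.pi_ne_zero, ENNReal.ofReal_one,
    one_mul]

lemma lintegral_channelLaw_succ (m : ℕ) {H : ℂ → (Fin m → ℂ) → ℝ≥0∞}
    (hH : Measurable fun p : ℂ × (Fin m → ℂ) => H p.1 p.2) :
    ∫⁻ g, H (g 0) (fun l => g l.succ) ∂(channelLaw (m + 1))
      = ∫⁻ z, ∫⁻ g, H z g ∂(channelLaw m) ∂complexGaussian := by
  have h := measurePreserving_piFinSuccAbove (fun _ : Fin (m + 1) => complexGaussian) 0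
  have h2 := h.lintegral_comp hH
  rw [lintegral_prod _ hH.aemeasurable] at h2
  exact h2

/-- Convolving with Exp(1) raises the Gamma shape by one. In the variable `t = x + y` the
exponentials combine to `e^{-t}`, and `∫₀ᵗ (t - x)^m / m! dx = t^{m+1} / (m+1)!`. -/
lemma lintegral_exp_conv_gamma (m : ℕ) {F : ℝ → ℝ≥0∞} (hF : Measurable F) :
    ∫⁻ x in Set.Ioi (0 : ℝ), (∫⁻ y in Set.Ioi (0 : ℝ), F (x + y)
        * ENNReal.ofReal (y ^ m / m.factorial * Real.exp (-y))) * ENNReal.ofReal (Real.exp (-x))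
      = ∫⁻ t in Set.Ioi (0 : ℝ), F t
        * ENNReal.ofReal (t ^ (m + 1) / (m + 1).factorial * Real.exp (-t)) := by
  -- The shift is made on the whole line, with the domain carried by an indicator, so that the order
  -- of integration can be exchanged.
  have h1 : ∀ x : ℝ, (∫⁻ y in Set.Ioi (0 : ℝ), F (x + y)
        * ENNReal.ofReal (y ^ m / m.factorial * Real.exp (-y))) * ENNReal.ofReal (Real.exp (-x))
      = ∫⁻ t, (Set.Ioi x).indicator (fun t => F t * (ENNReal.ofReal ((t - x) ^ m / m.factorial)
          * ENNReal.ofReal (Real.exp (-t)))) t := by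
    intro x
    rw [← lintegral_mul_const _ (by fun_prop), ← lintegral_indicator measurableSet_Ioi,
      ← lintegral_add_left_eq_self (fun t => (Set.Ioi x).indicator _ t) x]
    refine lintegral_congr fun y => ?_
    by_cases hy : 0 < y
    · rw [Set.indicator_of_mem (show y ∈ Set.Ioi 0 from hy),
        Set.indicator_of_mem (show x + y ∈ Set.Ioi x by simpa using hy), mul_assoc,
        ← ENNReal.ofReal_mul (by positivity), ← ENNReal.ofReal_mul (by
          rw [add_sub_cancel_left]; positivity), add_sub_cancel_left, mul_assoc,
        ← Real.exp_add]
      congr 4; ring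
    · rw [Set.indicator_of_notMem (by simpa using hy), Set.indicator_of_notMem (by simpa using hy)]
  simp_rw [h1]
  have hmeas : Measurable fun p : ℝ × ℝ => (Set.Ioi p.1).indicator
      (fun t => F t * (ENNReal.ofReal ((t - p.1) ^ m / m.factorial)
        * ENNReal.ofReal (Real.exp (-t)))) p.2 := by
    have : (fun p : ℝ × ℝ => (Set.Ioi p.1).indicator
      (fun t => F t * (ENNReal.ofReal ((t - p.1) ^ m / m.factorial)
        * ENNReal.ofReal (Real.exp (-t)))) p.2) = {p : ℝ × ℝ | p.1 < p.2}.indicator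
        (fun p => F p.2 * (ENNReal.ofReal ((p.2 - p.1) ^ m / m.factorial)
        * ENNReal.ofReal (Real.exp (-p.2)))) := by
      ext p; simp [Set.indicator]
    rw [this]
    exact Measurable.indicator (by fun_prop) (measurableSet_lt measurable_fst measurable_snd)
  rw [lintegral_lintegral_swap hmeas.aemeasurable, ← lintegral_indicator measurableSet_Ioi]
  refine lintegral_congr fun t => ?_
  by_cases ht : 0 < t
  · rw [Set.indicator_of_mem (show t ∈ Set.Ioi 0 from ht)]
    have h2 : ∀ x, (Set.Ioi x).indicator
        (fun t => F t * (ENNReal.ofReal ((t - x) ^ m / m.factorial)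
        * ENNReal.ofReal (Real.exp (-t)))) t = (Set.Iio t).indicator
        (fun x => ENNReal.ofReal ((t - x) ^ m / m.factorial)) x
          * (F t * ENNReal.ofReal (Real.exp (-t))) := by
      intro x
      by_cases hx : x < t
      · rw [Set.indicator_of_mem (show t ∈ Set.Ioi x from hx), Set.indicator_of_mem (by simpa)]
        ring
      · simp [hx]
    simp_rw [h2]
    rw [lintegral_mul_const _ (Measurable.indicator (by fun_prop) measurableSet_Iio),
      lintegral_indicator measurableSet_Iio, Measure.restrict_restrict measurableSet_Iio,
      Set.Iio_inter_Ioi]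
    have h3 : ∫⁻ x in Set.Ioo 0 t, ENNReal.ofReal ((t - x) ^ m / m.factorial)
        = ENNReal.ofReal (t ^ (m + 1) / (m + 1).factorial) := by
      rw [Measure.restrict_congr_set Ioo_ae_eq_Ioc,
        ← ofReal_integral_eq_lintegral_ofReal ((Continuous.integrableOn_Icc (by fun_prop)).mono_set
          Set.Ioc_subset_Icc_self) ?_, ← intervalIntegral.integral_of_le ht.le,
        intervalIntegral.integral_div]
      · congr 1
        rw [intervalIntegral.integral_comp_sub_left (fun y => y ^ m), integral_pow,
          Nat.factorial_succ]
        simp; field_simp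
      · refine (ae_restrict_iff' measurableSet_Ioc).2 (Filter.Eventually.of_forall fun x hx => ?_)
        have : 0 ≤ t - x := sub_nonneg.2 hx.2
        simp only [Pi.zero_apply]; positivity
    rw [h3, ENNReal.ofReal_mul (by positivity)]
    ring
  · rw [Set.indicator_of_notMem (by simpa using ht),
      setLIntegral_congr_fun (g := fun _ => 0) measurableSet_Ioi]
    · simp
    · intro x hx
      have : ¬ x < t := fun h => ht (lt_trans hx h)
      simp [this]

/-- Induction on the number of entries: each new one adds an independent Exp(1) variable. -/
lemma lintegral_sum_norm_sq_channelLaw (m : ℕ) {F : ℝ → ℝ≥0∞} (hF : Measurable F) :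
    ∫⁻ g, F (∑ l, ‖g l‖ ^ 2) ∂(channelLaw (m + 1))
      = ∫⁻ t in Set.Ioi (0 : ℝ), F t * ENNReal.ofReal (t ^ m / m.factorial * Real.exp (-t)) := by
  induction m generalizing F with
  | zero =>
    simp_rw [Fin.sum_univ_succ]
    rw [lintegral_channelLaw_succ 0 (H := fun z g => F (‖z‖ ^ 2 + ∑ i, ‖g i‖ ^ 2)) (by fun_prop)]
    simp [lintegral_norm_sq_complexGaussian hF]
  | succ m ih =>
    simp_rw [Fin.sum_univ_succ (n := m + 1)]
    rw [lintegral_channelLaw_succ (m + 1) (H := fun z g => F (‖z‖ ^ 2 + ∑ i, ‖g i‖ ^ 2))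
      (by fun_prop)]
    have h : ∀ z : ℂ, ∫⁻ g, F (‖z‖ ^ 2 + ∑ i, ‖g i‖ ^ 2) ∂(channelLaw (m + 1))
        = ∫⁻ t in Set.Ioi (0 : ℝ), F (‖z‖ ^ 2 + t)
          * ENNReal.ofReal (t ^ m / m.factorial * Real.exp (-t)) := fun z =>
      ih (F := fun t => F (‖z‖ ^ 2 + t)) (by fun_prop)
    simp_rw [h]
    rw [lintegral_norm_sq_complexGaussian (F := fun x => ∫⁻ t in Set.Ioi (0 : ℝ), F (x + t)
      * ENNReal.ofReal (t ^ m / m.factorial * Real.exp (-t)))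
      (Measurable.lintegral_prod_right' (f := fun p : ℝ × ℝ => F (p.1 + p.2)
        * ENNReal.ofReal (p.2 ^ m / m.factorial * Real.exp (-p.2))) (by fun_prop)),
      lintegral_exp_conv_gamma m hF]

lemma star_beam_dotProduct_beam {M : ℕ} {h : Fin M → ℂ} (hh : h ≠ 0) :
    star (beam h) ⬝ᵥ beam h = 1 := by
  have hpos : 0 < ∑ i, ‖h i‖ ^ 2 := by
    obtain ⟨i, hi⟩ := Function.ne_iff.1 hh
    exact Finset.sum_pos' (fun i _ => by positivity)
      ⟨i, Finset.mem_univ _, by have := norm_pos_iff.2 hi; positivity⟩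
  have h1 : ∀ i, star (beam h) i * beam h i = ((‖h i‖ ^ 2 / (∑ i, ‖h i‖ ^ 2) : ℝ) : ℂ) := by
    intro i
    rw [Pi.star_apply, Complex.star_def, Complex.conj_mul', ← Complex.ofReal_pow]
    congr 1
    rw [beam, norm_div, norm_star, Complex.norm_real, div_pow, Real.norm_eq_abs, sq_abs,
      Real.sq_sqrt hpos.le]
  rw [dotProduct, Finset.sum_congr rfl fun i _ => h1 i, ← Complex.ofReal_sum, ← Finset.sum_div,
    div_self hpos.ne', Complex.ofReal_one]

/-- The unitary matrix `[w W]` of the transmit directions. -/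
def txMatrix {m : ℕ} (V : NoisePrecoder (m + 1)) (h : Fin (m + 1) → ℂ) :
    Matrix (Fin (m + 1)) (Fin (m + 1)) ℂ :=
  Matrix.of fun i l => Fin.cons (α := fun _ => ℂ) (beam h i) (V.W h i) l

/-- The four blocks of the product are `‖w‖² = 1`, the orthogonality of `w` and `W` read in both
orders, and the orthonormality of the columns of `W`. -/
lemma txMatrix_unitary {m : ℕ} (V : NoisePrecoder (m + 1)) {h : Fin (m + 1) → ℂ} (hh : h ≠ 0) :
    (txMatrix V h)ᴴ * txMatrix V h = 1 := by
  have hW := V.orthonormal h hh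
  have hw := V.orthogonal h hh
  have hortho : ∀ l : Fin m, ∑ i, star (V.W h i l) * beam h i = 0 := fun l => congrFun hw l
  ext a b
  rw [Matrix.mul_apply]
  simp only [Matrix.conjTranspose_apply, txMatrix, Matrix.of_apply]
  refine Fin.cases ?_ (fun a => ?_) a <;> refine Fin.cases ?_ (fun b => ?_) b
  · simpa [dotProduct] using star_beam_dotProduct_beam hh
  · have := congrArg star (hortho b)
    simp only [star_sum, star_mul, star_star, star_zero] at this
    simpa [(Fin.succ_ne_zero b).symm] using this
  · simpa [(Fin.succ_ne_zero a)] using hortho a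
  · have := congrFun (congrFun hW a) b
    rw [Matrix.mul_apply] at this
    simpa [Matrix.one_apply] using this

/-- The Gamma density of shape `m + 1`. -/
def gammaDens (m : ℕ) (y : ℝ) : ℝ≥0∞ := ENNReal.ofReal (y ^ m / m.factorial * Real.exp (-y))

@[fun_prop]
lemma measurable_gammaDens (m : ℕ) : Measurable (gammaDens m) := by
  unfold gammaDens; fun_prop

/-- The signal gain and the noise gain are independent, with an exponential and a Gamma law. -/
lemma lintegral_gains {m : ℕ} (V : NoisePrecoder (m + 1 + 1)) {h : Fin (m + 1 + 1) → ℂ}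
    (hh : h ≠ 0) {F : ℝ → ℝ → ℝ≥0∞} (hF : Measurable fun p : ℝ × ℝ => F p.1 p.2) :
    ∫⁻ g, F (signalGain h g) (noiseGain V h g) ∂(channelLaw (m + 1 + 1))
      = ∫⁻ y in Set.Ioi (0 : ℝ), (∫⁻ x in Set.Ioi (0 : ℝ), F x y * ENNReal.ofReal (Real.exp (-x)))
        * gammaDens m y := by
  have hF2 : Measurable fun p : ℂ × (Fin (m + 1) → ℂ) => F (‖p.1‖ ^ 2) (∑ l, ‖p.2 l‖ ^ 2) :=
    hF.comp (f := fun p : ℂ × (Fin (m + 1) → ℂ) => (‖p.1‖ ^ 2, ∑ l, ‖p.2 l‖ ^ 2)) (by fun_prop)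
  -- The entries of `gᵀ[w W]` are `gᵀw` followed by `gᵀW`; after the unitary change of variables
  -- they are again i.i.d. Gaussian.
  have h0 : ∀ g, F (signalGain h g) (noiseGain V h g)
      = (fun g' : Fin (m + 1 + 1) → ℂ => F (‖g' 0‖ ^ 2) (∑ l : Fin (m + 1), ‖g' l.succ‖ ^ 2))
        (g ᵥ* txMatrix V h) := by
    intro g
    rfl
  have hmeas : Measurable
      (fun g' : Fin (m + 1 + 1) → ℂ => F (‖g' 0‖ ^ 2) (∑ l : Fin (m + 1), ‖g' l.succ‖ ^ 2)) :=
    hF.comp (f := fun g' : Fin (m + 1 + 1) → ℂ =>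
      (‖g' 0‖ ^ 2, ∑ l : Fin (m + 1), ‖g' l.succ‖ ^ 2)) (by fun_prop)
  rw [lintegral_congr h0, ← lintegral_map hmeas (by
    have : Continuous fun g : Fin (m + 1 + 1) → ℂ => g ᵥ* txMatrix V h := by fun_prop
    exact this.measurable), channelLaw_map_vecMul (txMatrix_unitary V hh),
    lintegral_channelLaw_succ (m + 1) (H := fun z g => F (‖z‖ ^ 2) (∑ l, ‖g l‖ ^ 2)) hF2,
    lintegral_lintegral_swap hF2.aemeasurable]
  have h1 : ∀ g : Fin (m + 1) → ℂ, ∫⁻ z, F (‖z‖ ^ 2) (∑ l, ‖g l‖ ^ 2) ∂complexGaussian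
      = (fun y => ∫⁻ x in Set.Ioi (0 : ℝ), F x y * ENNReal.ofReal (Real.exp (-x)))
        (∑ l, ‖g l‖ ^ 2) := fun g =>
    lintegral_norm_sq_complexGaussian (F := fun x => F x (∑ l, ‖g l‖ ^ 2))
      (hF.comp (measurable_id.prodMk measurable_const))
  rw [lintegral_congr h1, lintegral_sum_norm_sq_channelLaw m
    (F := fun y => ∫⁻ x in Set.Ioi (0 : ℝ), F x y * ENNReal.ofReal (Real.exp (-x)))]
  · rfl
  · exact Measurable.lintegral_prod_left' (f := fun p : ℝ × ℝ => F p.1 p.2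
      * ENNReal.ofReal (Real.exp (-p.1))) (by fun_prop)

lemma lintegral_rpow_mul_exp {a r : ℝ} (ha : 0 < a) (hr : 0 < r) :
    ∫⁻ t in Set.Ioi (0 : ℝ), ENNReal.ofReal (t ^ (a - 1) * Real.exp (-(r * t)))
      = ENNReal.ofReal ((1 / r) ^ a * Real.Gamma a) := by
  have hI := Real.integral_rpow_mul_exp_neg_mul_Ioi ha hr
  have hpos : 0 < (1 / r) ^ a * Real.Gamma a :=
    mul_pos (Real.rpow_pos_of_pos (by positivity) _) (Real.Gamma_pos_of_pos ha)
  rw [← hI, ofReal_integral_eq_lintegral_ofReal]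
  -- A nonintegrable function would have integral `0` by convention, whereas the known value is
  -- positive.
  · by_contra h
    rw [integral_undef h] at hI
    exact hpos.ne hI
  · refine (ae_restrict_iff' measurableSet_Ioi).2 (Filter.Eventually.of_forall fun t ht => ?_)
    have : (0 : ℝ) < t := ht
    simp only [Pi.zero_apply]; positivity

lemma lintegral_exp_Ioi {c : ℝ} :
    ∫⁻ x in Set.Ioi c, ENNReal.ofReal (Real.exp (-x)) = ENNReal.ofReal (Real.exp (-c)) := by
  rw [← integral_exp_neg_Ioi, ofReal_integral_eq_lintegral_ofReal]
  · exact integrableOn_exp_neg_Ioi c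
  · exact Filter.Eventually.of_forall fun x => (Real.exp_pos _).le

/-- The threshold may be `∞`, which covers divergent interference. -/
lemma lintegral_exp_tail (c : ℝ≥0∞) :
    ∫⁻ x in Set.Ioi (0 : ℝ), {x : ℝ | c ≤ ENNReal.ofReal x}.indicator 1 x
      * ENNReal.ofReal (Real.exp (-x)) = expNeg c := by
  induction c with
  | top => simp [expNeg_top]
  | coe c =>
    have hc : (0 : ℝ) ≤ c := c.2
    have h1 : ∀ x : ℝ, {x : ℝ | (c : ℝ≥0∞) ≤ ENNReal.ofReal x}.indicator 1 x
      * ENNReal.ofReal (Real.exp (-x)) = {x : ℝ | (c : ℝ≥0∞) ≤ ENNReal.ofReal x}.indicator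
        (fun x => ENNReal.ofReal (Real.exp (-x))) x := by
      intro x
      by_cases hx : (c : ℝ≥0∞) ≤ ENNReal.ofReal x <;> simp [Set.indicator, hx]
    have hms : MeasurableSet {x : ℝ | (c : ℝ≥0∞) ≤ ENNReal.ofReal x} :=
      measurableSet_le (by fun_prop) (by fun_prop)
    simp_rw [h1]
    rw [lintegral_indicator hms, Measure.restrict_restrict hms]
    have hae : ({x : ℝ | (c : ℝ≥0∞) ≤ ENNReal.ofReal x} ∩ Set.Ioi 0 : Set ℝ) =ᵐ[volume]
        Set.Ioi (c : ℝ) := by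
      have : ({x : ℝ | (c : ℝ≥0∞) ≤ ENNReal.ofReal x} ∩ Set.Ioi 0 : Set ℝ)
          = Set.Ici (c : ℝ) ∩ Set.Ioi 0 := by
        ext x
        simp only [Set.mem_inter_iff, Set.mem_ofPred_eq, Set.mem_Ioi, Set.mem_Ici]
        refine and_congr_left fun hx => ?_
        rw [← ENNReal.ofReal_coe_nnreal, ENNReal.ofReal_le_ofReal_iff hx.le]
      rw [this]
      have h2 := (Ioi_ae_eq_Ici (μ := (volume : Measure ℝ)) (a := (c : ℝ))).symm.inter
        (Filter.EventuallyEq.refl (ae volume) (Set.Ioi (0 : ℝ)))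
      rw [Set.Ioi_inter_Ioi, max_eq_left hc] at h2
      exact h2
    rw [Measure.restrict_congr_set hae, lintegral_exp_Ioi, ← ENNReal.ofReal_coe_nnreal,
      expNeg_ofReal hc]

lemma lintegral_gammaDens_expNeg (m : ℕ) {a : ℝ} (ha : 0 ≤ a) :
    ∫⁻ y in Set.Ioi (0 : ℝ), expNeg (ENNReal.ofReal a * ENNReal.ofReal y) * gammaDens m y
      = ENNReal.ofReal ((1 + a)⁻¹ ^ (m + 1)) := by
  have h1 : ∀ y ∈ Set.Ioi (0 : ℝ), expNeg (ENNReal.ofReal a * ENNReal.ofReal y) * gammaDens m y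
      = ENNReal.ofReal (m.factorial : ℝ)⁻¹
        * ENNReal.ofReal (y ^ ((m + 1 : ℝ) - 1) * Real.exp (-((1 + a) * y))) := by
    intro y hy
    have : (0 : ℝ) < y := hy
    rw [← ENNReal.ofReal_mul ha, expNeg_ofReal (by positivity), gammaDens,
      ← ENNReal.ofReal_mul (by positivity), ← ENNReal.ofReal_mul (by positivity)]
    congr 1
    rw [add_sub_cancel_right, Real.rpow_natCast, one_add_mul, neg_add, Real.exp_add]
    ring
  rw [setLIntegral_congr_fun measurableSet_Ioi h1, lintegral_const_mul _ (by fun_prop),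
    lintegral_rpow_mul_exp (by positivity) (by positivity), ← ENNReal.ofReal_mul (by positivity)]
  congr 1
  rw [Real.Gamma_nat_eq_factorial, one_div]
  have : (m + 1 : ℝ) = ((m + 1 : ℕ) : ℝ) := by push_cast; rfl
  rw [this, Real.rpow_natCast]
  have : (m.factorial : ℝ) ≠ 0 := by positivity
  field_simp

/-- Laplace transform of the artificial-noise gain. -/
lemma lintegral_expNeg_noiseGain {M : ℕ} (hM : 2 ≤ M) (V : NoisePrecoder M) {h : Fin M → ℂ}
    (hh : h ≠ 0) {a : ℝ} (ha : 0 ≤ a) :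
    ∫⁻ g, expNeg (ENNReal.ofReal a * ENNReal.ofReal (noiseGain V h g)) ∂(channelLaw M)
      = ENNReal.ofReal ((1 + a)⁻¹ ^ (M - 1)) := by
  obtain ⟨m, rfl⟩ : ∃ m, M = m + 1 + 1 := ⟨M - 2, by omega⟩
  rw [lintegral_gains V hh (F := fun _ y => expNeg (ENNReal.ofReal a * ENNReal.ofReal y))
    (by fun_prop), Nat.add_sub_cancel, ← lintegral_gammaDens_expNeg m ha]
  refine lintegral_congr fun y => ?_
  rw [lintegral_const_mul _ (by fun_prop), lintegral_exp_Ioi]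
  simp

/-- Probability that the signal gain exceeds the noise gain, scaled by `a`, plus `Y`. -/
lemma channelLaw_signalGain_ge {M : ℕ} (hM : 2 ≤ M) (V : NoisePrecoder M) {h : Fin M → ℂ}
    (hh : h ≠ 0) {a : ℝ} (ha : 0 ≤ a) (Y : ℝ≥0∞) :
    ∫⁻ g, {p : ℝ × ℝ | ENNReal.ofReal a * ENNReal.ofReal p.2 + Y ≤ ENNReal.ofReal p.1}.indicator 1
        (signalGain h g, noiseGain V h g) ∂(channelLaw M)
      = ENNReal.ofReal ((1 + a)⁻¹ ^ (M - 1)) * expNeg Y := by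
  obtain ⟨m, rfl⟩ : ∃ m, M = m + 1 + 1 := ⟨M - 2, by omega⟩
  rw [lintegral_gains V hh (F := fun x y => {p : ℝ × ℝ |
    ENNReal.ofReal a * ENNReal.ofReal p.2 + Y ≤ ENNReal.ofReal p.1}.indicator 1 (x, y))
    (measurable_one.indicator (measurableSet_le (by fun_prop) (by fun_prop))),
    Nat.add_sub_cancel, ← lintegral_gammaDens_expNeg m ha,
    ← lintegral_mul_const _ (by fun_prop)]
  refine lintegral_congr fun y => ?_
  -- Given the noise gain `y`, the exponential tail is `e^{-ay} e^{-Y}`; only the first factor has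
  -- to be averaged against the Gamma law.
  have := lintegral_exp_tail (ENNReal.ofReal a * ENNReal.ofReal y + Y)
  rw [expNeg_add] at this
  rw [mul_right_comm, ← this]
  rfl

/-! ### Interference integrals -/

/-- The inner integral is `1 - exp(-b r^{-1/δ})`. After exchanging the integrals, the admissible `r`
for fixed `x` fill `(0, (b/x)^δ)`, which leaves `b^δ ∫ x^{-δ} e^{-x} dx`, finite because `δ < 1`. -/
lemma lintegral_one_sub_exp_pathloss {b δ : ℝ} (hδ0 : 0 < δ) (hδ : δ < 1) (hb : 0 < b) :
    ∫⁻ r in Set.Ioi (0 : ℝ), ∫⁻ x in Set.Ioi (0 : ℝ),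
        {p : ℝ × ℝ | p.1 * p.2 ^ δ⁻¹ < b}.indicator 1 (x, r) * ENNReal.ofReal (Real.exp (-x))
      = ENNReal.ofReal (b ^ δ * Real.Gamma (1 - δ)) := by
  have hms : MeasurableSet {p : ℝ × ℝ | p.1 * p.2 ^ δ⁻¹ < b} :=
    measurableSet_lt (by fun_prop) (by fun_prop)
  have hmeas : Measurable fun p : ℝ × ℝ => {p : ℝ × ℝ | p.1 * p.2 ^ δ⁻¹ < b}.indicator
      (1 : ℝ × ℝ → ℝ≥0∞) p := measurable_one.indicator hms
  rw [lintegral_lintegral_swap (Measurable.aemeasurable (by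
    have : Measurable fun p : ℝ × ℝ => {p : ℝ × ℝ | p.1 * p.2 ^ δ⁻¹ < b}.indicator
      (1 : ℝ × ℝ → ℝ≥0∞) (p.2, p.1) := hmeas.comp measurable_swap
    exact this.mul (by fun_prop)))]
  have h1 : ∀ x ∈ Set.Ioi (0 : ℝ), ∫⁻ r in Set.Ioi (0 : ℝ),
      {p : ℝ × ℝ | p.1 * p.2 ^ δ⁻¹ < b}.indicator 1 (x, r) * ENNReal.ofReal (Real.exp (-x))
      = ENNReal.ofReal (b ^ δ) * ENNReal.ofReal (x ^ ((1 - δ) - 1) * Real.exp (-(1 * x))) := by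
    intro x hx
    have hx0 : (0 : ℝ) < x := hx
    rw [lintegral_mul_const' _ _ ENNReal.ofReal_ne_top]
    have h2 : ∀ r ∈ Set.Ioi (0 : ℝ), {p : ℝ × ℝ | p.1 * p.2 ^ δ⁻¹ < b}.indicator
        (1 : ℝ × ℝ → ℝ≥0∞) (x, r) = (Set.Iio ((b / x) ^ δ)).indicator 1 r := by
      intro r hr
      have hr0 : (0 : ℝ) < r := hr
      have : x * r ^ δ⁻¹ < b ↔ r < (b / x) ^ δ := by
        rw [mul_comm, ← lt_div_iff₀ hx0, Real.rpow_inv_lt_iff_of_pos hr0.le (by positivity) hδ0]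
      by_cases h : x * r ^ δ⁻¹ < b
      · rw [Set.indicator_of_mem (show (x, r) ∈ _ from h),
          Set.indicator_of_mem (Set.mem_Iio.2 (this.1 h))]
        rfl
      · rw [Set.indicator_of_notMem (show (x, r) ∉ _ from h),
          Set.indicator_of_notMem (fun h' => h (this.2 (Set.mem_Iio.1 h')))]
    rw [setLIntegral_congr_fun measurableSet_Ioi h2, lintegral_indicator_one measurableSet_Iio,
      Measure.restrict_apply measurableSet_Iio, Set.Iio_inter_Ioi, Real.volume_Ioo, sub_zero,
      ← ENNReal.ofReal_mul (by positivity), ← ENNReal.ofReal_mul (by positivity)]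
    congr 1
    rw [Real.div_rpow hb.le hx0.le, one_mul, show (1 - δ) - 1 = -δ by ring,
      Real.rpow_neg hx0.le]
    ring
  rw [setLIntegral_congr_fun measurableSet_Ioi h1, lintegral_const_mul _ (by fun_prop),
    lintegral_rpow_mul_exp (by linarith) one_pos, ← ENNReal.ofReal_mul (by positivity)]
  simp

lemma one_sub_expNeg_eq_lintegral {q : ℝ} (hq : 0 ≤ q) :
    ENNReal.ofReal (1 - Real.exp (-q))
      = ∫⁻ x in Set.Ioi (0 : ℝ), (Set.Iio q).indicator 1 x * ENNReal.ofReal (Real.exp (-x)) := by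
  have h1 : ∀ x : ℝ, (Set.Iio q).indicator 1 x * ENNReal.ofReal (Real.exp (-x))
      = (Set.Iio q).indicator (fun x => ENNReal.ofReal (Real.exp (-x))) x := by
    intro x
    by_cases hx : x < q <;> simp [Set.indicator, hx]
  simp_rw [h1]
  rw [lintegral_indicator measurableSet_Iio, Measure.restrict_restrict measurableSet_Iio,
    Set.Iio_inter_Ioi, Measure.restrict_congr_set Ioo_ae_eq_Ioc,
    ← ofReal_integral_eq_lintegral_ofReal ((Continuous.integrableOn_Icc (by fun_prop)).mono_set
      Set.Ioc_subset_Icc_self) (Filter.Eventually.of_forall fun x => (Real.exp_pos _).le),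
    ← intervalIntegral.integral_of_le hq]
  congr 1
  rw [intervalIntegral.integral_comp_neg (fun x => Real.exp x), integral_exp]
  simp

/-- The power `(1 + a)^{-(m+1)}` is the mean of `e^{-ay}` for a Gamma variable `y` of shape `m + 1`.
The exponential case with `b = sy` is averaged over `y`, and the moment `E y^δ = Γ(m+1+δ) / m!`
appears. -/
lemma lintegral_one_sub_gamma_pathloss (m : ℕ) {s δ : ℝ} (hδ0 : 0 < δ) (hδ : δ < 1) (hs : 0 ≤ s) :
    ∫⁻ r in Set.Ioi (0 : ℝ), ENNReal.ofReal (1 - (1 + s / r ^ δ⁻¹)⁻¹ ^ (m + 1))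
      = ENNReal.ofReal (s ^ δ * (Real.Gamma (m + 1 + δ) * Real.Gamma (1 - δ)
        / Real.Gamma (m + 1))) := by
  -- The exponential case needs `b > 0`; for `s = 0` both sides vanish.
  rcases hs.eq_or_lt with rfl | hs
  · simp [Real.zero_rpow hδ0.ne']
  have h1 : ∀ r ∈ Set.Ioi (0 : ℝ), ENNReal.ofReal (1 - (1 + s / r ^ δ⁻¹)⁻¹ ^ (m + 1))
      = ∫⁻ y in Set.Ioi (0 : ℝ), (∫⁻ x in Set.Ioi (0 : ℝ),
        {p : ℝ × ℝ | p.1 * p.2 ^ δ⁻¹ < s * y}.indicator 1 (x, r) * ENNReal.ofReal (Real.exp (-x)))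
          * gammaDens m y := by
    intro r hr
    have hr0 : (0 : ℝ) < r := hr
    have hrp : 0 < r ^ δ⁻¹ := Real.rpow_pos_of_pos hr0 _
    have hq : 0 ≤ s / r ^ δ⁻¹ := by positivity
    have h2 : ∀ y ∈ Set.Ioi (0 : ℝ), (∫⁻ x in Set.Ioi (0 : ℝ),
        {p : ℝ × ℝ | p.1 * p.2 ^ δ⁻¹ < s * y}.indicator 1 (x, r) * ENNReal.ofReal (Real.exp (-x)))
          * gammaDens m y = gammaDens m y
            - expNeg (ENNReal.ofReal (s / r ^ δ⁻¹) * ENNReal.ofReal y) * gammaDens m y := by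
      intro y hy
      have hy0 : (0 : ℝ) < y := hy
      have h3 : ∀ x : ℝ, {p : ℝ × ℝ | p.1 * p.2 ^ δ⁻¹ < s * y}.indicator (1 : ℝ × ℝ → ℝ≥0∞) (x, r)
          = (Set.Iio (s / r ^ δ⁻¹ * y)).indicator 1 x := by
        intro x
        have : x * r ^ δ⁻¹ < s * y ↔ x < s / r ^ δ⁻¹ * y := by
          rw [div_mul_eq_mul_div, lt_div_iff₀ hrp]
        by_cases h : x * r ^ δ⁻¹ < s * y
        · rw [Set.indicator_of_mem (show (x, r) ∈ _ from h),
            Set.indicator_of_mem (Set.mem_Iio.2 (this.1 h))]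
          rfl
        · rw [Set.indicator_of_notMem (show (x, r) ∉ _ from h),
            Set.indicator_of_notMem (fun h' => h (this.2 (Set.mem_Iio.1 h')))]
      simp_rw [h3]
      rw [← one_sub_expNeg_eq_lintegral (by positivity), ← ENNReal.ofReal_mul hq,
        expNeg_ofReal (by positivity), ENNReal.ofReal_sub _ (Real.exp_pos _).le,
        ENNReal.sub_mul (fun _ _ => by simp [gammaDens]), ENNReal.ofReal_one, one_mul]
    have htot : ∫⁻ y in Set.Ioi (0 : ℝ), gammaDens m y = 1 := by
      have := lintegral_gammaDens_expNeg m le_rfl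
      simpa [expNeg_zero] using this
    rw [setLIntegral_congr_fun measurableSet_Ioi h2, lintegral_sub (by fun_prop), htot,
      lintegral_gammaDens_expNeg m hq, ENNReal.ofReal_sub _ (by positivity), ENNReal.ofReal_one]
    · rw [lintegral_gammaDens_expNeg m hq]; exact ENNReal.ofReal_ne_top
    · exact Filter.Eventually.of_forall fun y =>
        mul_le_of_le_one_left zero_le (expNeg_le_one _)
  have hmeas : Measurable fun p : (ℝ × ℝ) × ℝ => {p : (ℝ × ℝ) × ℝ |
      p.2 * p.1.1 ^ δ⁻¹ < s * p.1.2}.indicator (1 : (ℝ × ℝ) × ℝ → ℝ≥0∞) p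
        * ENNReal.ofReal (Real.exp (-p.2)) :=
    (measurable_one.indicator (measurableSet_lt (by fun_prop) (by fun_prop))).mul (by fun_prop)
  rw [setLIntegral_congr_fun measurableSet_Ioi h1, lintegral_lintegral_swap
    (Measurable.aemeasurable ((hmeas.lintegral_prod_right' (ν := volume.restrict (Set.Ioi 0))).mul
      (by fun_prop : Measurable fun p : ℝ × ℝ => gammaDens m p.2)))]
  have h4 : ∀ y ∈ Set.Ioi (0 : ℝ), ∫⁻ r in Set.Ioi (0 : ℝ), (∫⁻ x in Set.Ioi (0 : ℝ),
        {p : ℝ × ℝ | p.1 * p.2 ^ δ⁻¹ < s * y}.indicator 1 (x, r) * ENNReal.ofReal (Real.exp (-x)))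
          * gammaDens m y
      = ENNReal.ofReal (s ^ δ * (Real.Gamma (1 - δ) / m.factorial))
        * ENNReal.ofReal (y ^ ((m + 1 + δ) - 1) * Real.exp (-(1 * y))) := by
    intro y hy
    have hy0 : (0 : ℝ) < y := hy
    have hG : 0 < Real.Gamma (1 - δ) := Real.Gamma_pos_of_pos (by linarith)
    rw [lintegral_mul_const' _ _ (by simp [gammaDens]),
      lintegral_one_sub_exp_pathloss hδ0 hδ (by positivity), gammaDens,
      ← ENNReal.ofReal_mul (by positivity), ← ENNReal.ofReal_mul (by positivity)]
    congr 1
    rw [Real.mul_rpow hs.le hy0.le, show (m + 1 + δ) - 1 = m + δ by ring, Real.rpow_add hy0,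
      Real.rpow_natCast, one_mul]
    ring
  rw [setLIntegral_congr_fun measurableSet_Ioi h4, lintegral_const_mul _ (by fun_prop),
    lintegral_rpow_mul_exp (by positivity) one_pos, ← ENNReal.ofReal_mul]
  · congr 1
    rw [Real.Gamma_nat_eq_factorial]
    simp; ring
  · have hG : 0 < Real.Gamma (1 - δ) := Real.Gamma_pos_of_pos (by linarith)
    positivity

lemma lintegral_plane_dist_sq (e : Plane) {F : ℝ → ℝ≥0∞} (hF : Measurable F) :
    ∫⁻ z : Plane, F (dist e z ^ 2) = ENNReal.ofReal Real.pi * ∫⁻ t in Set.Ioi (0 : ℝ), F t := by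
  simp_rw [dist_eq_norm]
  rw [lintegral_sub_left_eq_self (fun z => F (‖z‖ ^ 2)) e, ← lintegral_radial_prod hF,
    ← (volume_preserving_finTwoArrow ℝ).lintegral_comp (by fun_prop),
    ← (EuclideanSpace.volume_preserving_symm_measurableEquiv_toLp (Fin 2)).lintegral_comp
      (by fun_prop)]
  refine lintegral_congr fun z => ?_
  rw [EuclideanSpace.norm_sq_eq]
  simp

/-! ### Probabilistic tools: convexity, independence, conditioning, nearest point -/

/-- Jensen's inequality for `x ↦ e^{-x}`. -/
lemma expNeg_lintegral_le {Ω : Type*} [MeasurableSpace Ω] {P : Measure Ω} [IsProbabilityMeasure P]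
    {Y : Ω → ℝ≥0∞} (hY : Measurable Y) : expNeg (∫⁻ ω, Y ω ∂P) ≤ ∫⁻ ω, expNeg (Y ω) ∂P := by
  by_cases hm : ∫⁻ ω, Y ω ∂P = ∞
  · simp [hm, expNeg_top]
  obtain ⟨m, hm0, hme⟩ : ∃ m : ℝ, 0 ≤ m ∧ ∫⁻ ω, Y ω ∂P = ENNReal.ofReal m :=
    ⟨_, ENNReal.toReal_nonneg, (ENNReal.ofReal_toReal hm).symm⟩
  set q := ENNReal.ofReal (Real.exp (-m)) with hq
  -- The tangent line of `e^{-y}` at the mean `m`, with the negative term moved across to avoid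
  -- truncated subtraction.
  have hpt : ∀ y : ℝ≥0∞, q + q * ENNReal.ofReal m ≤ expNeg y + q * y := by
    intro y
    by_cases hy : y = ∞
    · simp [hy, hq, ENNReal.mul_top, Real.exp_pos]
    obtain ⟨t, ht0, rfl⟩ : ∃ t : ℝ, 0 ≤ t ∧ y = ENNReal.ofReal t :=
      ⟨_, ENNReal.toReal_nonneg, (ENNReal.ofReal_toReal hy).symm⟩
    rw [expNeg_ofReal ht0, hq, ← ENNReal.ofReal_mul (by positivity),
      ← ENNReal.ofReal_mul (by positivity), ← ENNReal.ofReal_add (by positivity) (by positivity),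
      ← ENNReal.ofReal_add (by positivity) (by positivity)]
    apply ENNReal.ofReal_le_ofReal
    have h := Real.add_one_le_exp (m - t)
    have h2 : Real.exp (-t) = Real.exp (-m) * Real.exp (m - t) := by
      rw [← Real.exp_add]; congr 1; ring
    rw [h2]
    nlinarith [mul_le_mul_of_nonneg_left h (Real.exp_pos (-m)).le]
  have hint : q + q * ENNReal.ofReal m ≤ ∫⁻ ω, expNeg (Y ω) ∂P + q * ENNReal.ofReal m := by
    calc q + q * ENNReal.ofReal m = ∫⁻ _, (q + q * ENNReal.ofReal m) ∂P := by simp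
      _ ≤ ∫⁻ ω, (expNeg (Y ω) + q * Y ω) ∂P := lintegral_mono fun ω => hpt (Y ω)
      _ = _ := by
        rw [lintegral_add_left (by fun_prop), lintegral_const_mul _ hY, hme]
  rw [hme, expNeg_ofReal hm0]
  exact (ENNReal.add_le_add_iff_right (by
    rw [hq, ← ENNReal.ofReal_mul (by positivity)]; exact ENNReal.ofReal_ne_top)).1 hint

/-- Finite products factor by independence, and both sides are their limits, by dominated
convergence with bound `1`. A factor equal to `0` has `negLog` equal to `∞`. -/
lemma lintegral_expNeg_tsum_infinitePi {E : Type*} [MeasurableSpace E] (μ : Measure E)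
    [IsProbabilityMeasure μ] {f : ℕ → E → ℝ≥0∞} (hf : ∀ n, Measurable (f n)) :
    ∫⁻ x, expNeg (∑' n, f n (x n)) ∂(Measure.infinitePi fun _ : ℕ => μ)
      = expNeg (∑' n, negLog (∫⁻ y, expNeg (f n y) ∂μ)) := by
  have hle : ∀ n, ∫⁻ y, expNeg (f n y) ∂μ ≤ 1 := fun n =>
    (lintegral_mono fun y => expNeg_le_one _).trans (by simp)
  have h1 := tendsto_expNeg_tsum fun n => negLog (∫⁻ y, expNeg (f n y) ∂μ)
  simp_rw [expNeg_negLog (hle _)] at h1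
  refine tendsto_nhds_unique ?_ h1
  have h2 : ∀ N : ℕ, ∏ n ∈ Finset.range N, ∫⁻ y, expNeg (f n y) ∂μ
      = ∫⁻ x, ∏ n ∈ Finset.range N, expNeg (f n (x n)) ∂(Measure.infinitePi fun _ : ℕ => μ) := by
    intro N
    have hind : iIndepFun (fun (n : ℕ) (x : ℕ → E) => expNeg (f n (x n)))
        (Measure.infinitePi fun _ : ℕ => μ) :=
      iIndepFun_infinitePi (P := fun _ : ℕ => μ) (X := fun n y => expNeg (f n y))
        (fun n => by fun_prop)
    rw [lintegral_prod_eq_prod_lintegral_of_indepFun _ _ hind (fun n => by fun_prop)]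
    refine Finset.prod_congr rfl fun n _ => ?_
    exact ((measurePreserving_eval_infinitePi (fun _ : ℕ => μ) n).lintegral_comp
      (by fun_prop : Measurable fun y => expNeg (f n y))).symm
  simp_rw [h2]
  refine tendsto_lintegral_of_dominated_convergence (fun _ => 1) (fun N => by fun_prop)
    (fun N => Filter.Eventually.of_forall fun x => Finset.prod_le_one' fun n _ => expNeg_le_one _)
    (by simp) (Filter.Eventually.of_forall fun x => tendsto_expNeg_tsum _)

lemma lintegral_prod_pi {ι : Type*} [Fintype ι] {E : ι → Type*} [∀ i, MeasurableSpace (E i)]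
    (μ : ∀ i, Measure (E i)) [∀ i, IsProbabilityMeasure (μ i)] {f : ∀ i, E i → ℝ≥0∞}
    (hf : ∀ i, Measurable (f i)) :
    ∫⁻ x, ∏ i, f i (x i) ∂(Measure.pi μ) = ∏ i, ∫⁻ y, f i y ∂(μ i) := by
  have hind : iIndepFun (fun i (x : ∀ i, E i) => f i (x i)) (Measure.pi μ) :=
    iIndepFun_pi (fun i => (hf i).aemeasurable)
  rw [lintegral_prod_eq_prod_lintegral_of_indepFun _ _ hind
    (fun i => (hf i).comp (measurable_pi_apply i))]
  refine Finset.prod_congr rfl fun i _ => ?_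
  exact (measurePreserving_eval μ i).lintegral_comp (hf i)

/-- Conditional probability, given `X`, of an event determined by `X` and an independent `Y`. -/
lemma condProb_of_indepFun {Ω E F : Type*} [mΩ : MeasurableSpace Ω] [mE : MeasurableSpace E]
    [MeasurableSpace F] {P : Measure Ω} [IsProbabilityMeasure P] {X : Ω → E} {Y : Ω → F}
    (hX : Measurable X) (hY : Measurable Y) (h : IndepFun X Y P) {S : Set (E × F)}
    (hS : MeasurableSet S) :
    P⟦{ω | (X ω, Y ω) ∈ S} | mE.comap X⟧
      =ᵐ[P] fun ω => ((P.map Y) (Prod.mk (X ω) ⁻¹' S)).toReal := by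
  have hPY : IsProbabilityMeasure (P.map Y) := Measure.isProbabilityMeasure_map hY.aemeasurable
  have hSm : MeasurableSet {ω | (X ω, Y ω) ∈ S} := (hX.prodMk hY) hS
  have hg : Measurable fun x => (P.map Y) (Prod.mk x ⁻¹' S) := measurable_measure_prodMk_left hS
  have hint : Integrable (fun ω => ((P.map Y) (Prod.mk (X ω) ⁻¹' S)).toReal) P := by
    refine Integrable.of_bound (C := 1) (hg.comp hX).ennreal_toReal.aestronglyMeasurable
      (Filter.Eventually.of_forall fun ω => ?_)
    rw [Real.norm_of_nonneg ENNReal.toReal_nonneg]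
    exact ENNReal.toReal_le_of_le_ofReal zero_le_one (by simpa using prob_le_one)
  symm
  -- The defining property of conditional expectation is checked on sets `X ∈ B`, where it is
  -- Tonelli for the product law of `(X, Y)`.
  refine ae_eq_condExp_of_forall_setIntegral_eq hX.comap_le
    ((integrable_const (1 : ℝ)).indicator hSm) (fun _ _ _ => hint.integrableOn) ?_ ?_
  · rintro _ ⟨B, hB, rfl⟩ _
    rw [integral_indicator hSm, Measure.restrict_restrict hSm, setIntegral_const, smul_eq_mul,
      mul_one, integral_toReal (f := fun ω => (P.map Y) (Prod.mk (X ω) ⁻¹' S))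
        (hg.comp hX).aemeasurable
        (Filter.Eventually.of_forall fun ω => measure_lt_top _ _), measureReal_def]
    congr 1
    have h1 : ∫⁻ ω in X ⁻¹' B, (P.map Y) (Prod.mk (X ω) ⁻¹' S) ∂P
        = ∫⁻ x in B, (P.map Y) (Prod.mk x ⁻¹' S) ∂(P.map X) := (setLIntegral_map hB hg hX).symm
    have h2 : ({ω | (X ω, Y ω) ∈ S} ∩ X ⁻¹' B)
        = (fun ω => (X ω, Y ω)) ⁻¹' (S ∩ B ×ˢ Set.univ) := by
      ext ω; simp
    rw [h1, h2, ← Measure.map_apply (hX.prodMk hY) (hS.inter (hB.prod MeasurableSet.univ)),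
      (indepFun_iff_map_prod_eq_prod_map_map hX.aemeasurable hY.aemeasurable).1 h,
      Measure.prod_apply (hS.inter (hB.prod MeasurableSet.univ)), ← lintegral_indicator hB]
    refine lintegral_congr fun x => ?_
    by_cases hx : x ∈ B
    · rw [Set.indicator_of_mem hx]
      congr 1; ext y; simp [hx]
    · rw [Set.indicator_of_notMem hx]
      symm
      convert measure_empty (μ := P.map Y)
      ext y; simp [hx]
  · exact (hg.ennreal_toReal.comp (comap_measurable X)).aestronglyMeasurable

lemma tprod_toReal_expNeg (f : ℕ → ℝ≥0∞) :
    ∏' i, (expNeg (f i)).toReal = (expNeg (∑' i, f i)).toReal := by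
  refine HasProd.tprod_eq ?_
  have h1 : ∀ s : Finset ℕ, ∏ i ∈ s, (expNeg (f i)).toReal = (expNeg (∑ i ∈ s, f i)).toReal := by
    intro s
    rw [expNeg_sum, ENNReal.toReal_prod]
  simp only [HasProd, h1]
  exact (ENNReal.tendsto_toReal (expNeg_ne_top _)).comp
    ((continuous_expNeg.tendsto _).comp ENNReal.summable.hasSum)

/-- Among the functions with values in `[0, 1]` and given integral, the indicator of a disc
maximises the integral against the density of the nearest point of a Poisson process. -/
lemma lintegral_nearest_le {lam : ℝ} (hlam : 0 < lam) (b : Plane) {g : Plane → ℝ≥0∞}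
    (hg : Measurable g) (hg1 : ∀ x, g x ≤ 1) :
    ∫⁻ x, ENNReal.ofReal (lam * Real.exp (-(lam * Real.pi * dist b x ^ 2))) * g x
      ≤ 1 - expNeg (ENNReal.ofReal lam * ∫⁻ x, g x) := by
  have hpi := Real.pi_pos
  -- The probability that the nearest point lies in the disc of squared radius `ρ`.
  have hrad : ∀ ρ : ℝ, 0 ≤ ρ → ∫⁻ x : Plane, (Set.Iio ρ).indicator
      (fun r => ENNReal.ofReal (lam * Real.exp (-(lam * Real.pi * r)))) (dist b x ^ 2)
      = ENNReal.ofReal (1 - Real.exp (-(lam * Real.pi * ρ))) := by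
    intro ρ hρ
    rw [lintegral_plane_dist_sq b (Measurable.indicator (by fun_prop) measurableSet_Iio),
      lintegral_indicator measurableSet_Iio, Measure.restrict_restrict measurableSet_Iio,
      Set.Iio_inter_Ioi, Measure.restrict_congr_set Ioo_ae_eq_Ioc,
      ← ofReal_integral_eq_lintegral_ofReal ((Continuous.integrableOn_Icc (by fun_prop)).mono_set
        Set.Ioc_subset_Icc_self) (Filter.Eventually.of_forall fun x => by positivity),
      ← intervalIntegral.integral_of_le hρ, ← ENNReal.ofReal_mul hpi.le]
    congr 1
    have hd : ∀ x ∈ Set.uIcc 0 ρ, HasDerivAt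
        (fun r => -(Real.pi⁻¹ * Real.exp (-(lam * Real.pi * r))))
        (lam * Real.exp (-(lam * Real.pi * x))) x := by
      intro x _
      have h1 : HasDerivAt (fun r : ℝ => -(lam * Real.pi * r)) (-(lam * Real.pi)) x := by
        simpa using ((hasDerivAt_id x).const_mul (lam * Real.pi)).fun_neg
      have h2 := (h1.exp.const_mul Real.pi⁻¹).fun_neg
      have h3 : -(Real.pi⁻¹ * (Real.exp (-(lam * Real.pi * x)) * -(lam * Real.pi)))
          = lam * Real.exp (-(lam * Real.pi * x)) := by
        field_simp
      rw [h3] at h2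
      exact h2
    rw [intervalIntegral.integral_eq_sub_of_hasDerivAt hd
      (Continuous.intervalIntegrable (by fun_prop) _ _)]
    simp only [mul_zero, neg_zero, Real.exp_zero]
    field_simp
    ring
  have hw : Measurable fun x : Plane =>
      ENNReal.ofReal (lam * Real.exp (-(lam * Real.pi * dist b x ^ 2))) := by fun_prop
  -- If `∫ g = ∞` the bound is `1`, and it suffices that the density has total mass at most `1`, by
  -- exhaustion with discs.
  by_cases hG : ∫⁻ x, g x = ∞
  · rw [hG, ENNReal.mul_top (by simpa using hlam), expNeg_top, tsub_zero]
    have hmono : Monotone fun (n : ℕ) => fun x : Plane => (Set.Iio (n : ℝ)).indicator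
      (fun r => ENNReal.ofReal (lam * Real.exp (-(lam * Real.pi * r)))) (dist b x ^ 2) := by
      intro m n hmn x
      exact Set.indicator_le_indicator_of_subset
        (Set.Iio_subset_Iio (by exact_mod_cast hmn)) (fun _ => zero_le) _
    have hsup : ∀ x : Plane, ENNReal.ofReal (lam * Real.exp (-(lam * Real.pi * dist b x ^ 2)))
        ≤ ⨆ n : ℕ, (Set.Iio (n : ℝ)).indicator
      (fun r => ENNReal.ofReal (lam * Real.exp (-(lam * Real.pi * r)))) (dist b x ^ 2) := by
      intro x
      obtain ⟨n, hn⟩ := exists_nat_gt (dist b x ^ 2)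
      refine le_trans ?_ (le_iSup _ n)
      rw [Set.indicator_of_mem (show dist b x ^ 2 ∈ Set.Iio (n : ℝ) from hn)]
    calc _ ≤ ∫⁻ x : Plane, ⨆ n : ℕ, (Set.Iio (n : ℝ)).indicator
            (fun r => ENNReal.ofReal (lam * Real.exp (-(lam * Real.pi * r)))) (dist b x ^ 2) :=
          lintegral_mono fun x => (mul_le_of_le_one_right zero_le (hg1 x)).trans (hsup x)
      _ = ⨆ n : ℕ, ENNReal.ofReal (1 - Real.exp (-(lam * Real.pi * n))) := by
          rw [lintegral_iSup (fun n => ?_) hmono]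
          · simp_rw [hrad _ (Nat.cast_nonneg _)]
          · have : Measurable fun r : ℝ => (Set.Iio (n : ℝ)).indicator
              (fun r => ENNReal.ofReal (lam * Real.exp (-(lam * Real.pi * r)))) r :=
              Measurable.indicator (by fun_prop) measurableSet_Iio
            exact this.comp (by fun_prop)
      _ ≤ 1 := iSup_le fun n => by
          rw [← ENNReal.ofReal_one]
          exact ENNReal.ofReal_le_ofReal (by linarith [Real.exp_pos (-(lam * Real.pi * n))])
  obtain ⟨I, hI0, hI⟩ : ∃ I : ℝ, 0 ≤ I ∧ ∫⁻ x, g x = ENNReal.ofReal I :=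
    ⟨_, ENNReal.toReal_nonneg, (ENNReal.ofReal_toReal hG).symm⟩
  -- The disc of squared radius `ρ` has area `I = ∫ g`; below, `t` is the value of the density on
  -- its boundary.
  set ρ := I / Real.pi with hρ
  have hρ0 : 0 ≤ ρ := by positivity
  have hρI : lam * Real.pi * ρ = lam * I := by rw [hρ]; field_simp
  set t := lam * Real.exp (-(lam * I)) with ht
  have ht0 : 0 ≤ t := by positivity
  -- Writing `w` for the density, this is `(w - t)(g - 1_disc) ≤ 0` rearranged: `w ≥ t` and `g ≤ 1`
  -- inside the disc, `w ≤ t` and `g ≥ 0` outside. Integrated, the two terms with `t` cancel, as `g`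
  -- and the disc have equal mass.
  have hpt : ∀ x : Plane, ENNReal.ofReal (lam * Real.exp (-(lam * Real.pi * dist b x ^ 2))) * g x
      + (Set.Iio ρ).indicator (fun _ => ENNReal.ofReal t) (dist b x ^ 2)
      ≤ (Set.Iio ρ).indicator
        (fun r => ENNReal.ofReal (lam * Real.exp (-(lam * Real.pi * r)))) (dist b x ^ 2)
        + ENNReal.ofReal t * g x := by
    intro x
    obtain ⟨γ, hγ0, hγ⟩ : ∃ γ : ℝ, 0 ≤ γ ∧ g x = ENNReal.ofReal γ :=
      ⟨_, ENNReal.toReal_nonneg,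
        (ENNReal.ofReal_toReal ((hg1 x).trans_lt ENNReal.one_lt_top).ne).symm⟩
    have hγ1 : γ ≤ 1 := by
      have := hg1 x
      rw [hγ, ENNReal.ofReal_le_one] at this
      exact this
    set d := dist b x ^ 2
    by_cases hd : d < ρ
    · rw [Set.indicator_of_mem (Set.mem_Iio.2 hd), Set.indicator_of_mem (Set.mem_Iio.2 hd), hγ,
        ← ENNReal.ofReal_mul (by positivity), ← ENNReal.ofReal_mul ht0,
        ← ENNReal.ofReal_add (by positivity) ht0,
        ← ENNReal.ofReal_add (by positivity) (by positivity)]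
      apply ENNReal.ofReal_le_ofReal
      have hle : t ≤ lam * Real.exp (-(lam * Real.pi * d)) := by
        rw [ht, ← hρI]; gcongr
      nlinarith
    · rw [Set.indicator_of_notMem (by simpa using hd), Set.indicator_of_notMem (by simpa using hd),
        zero_add, add_zero]
      gcongr
      rw [ht, ← hρI]
      have : ρ ≤ d := not_lt.1 hd
      gcongr
  have hI1 : ∫⁻ x : Plane, (Set.Iio ρ).indicator (fun _ => ENNReal.ofReal t) (dist b x ^ 2)
      = ENNReal.ofReal (t * I) := by
    rw [lintegral_plane_dist_sq b (Measurable.indicator (by fun_prop) measurableSet_Iio),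
      lintegral_indicator measurableSet_Iio, Measure.restrict_restrict measurableSet_Iio,
      Set.Iio_inter_Ioi, setLIntegral_const, Real.volume_Ioo, sub_zero,
      ← ENNReal.ofReal_mul ht0, ← ENNReal.ofReal_mul hpi.le]
    congr 1
    rw [hρ]; field_simp
  have hsum := lintegral_mono (μ := (volume : Measure Plane)) hpt
  rw [lintegral_add_left (by fun_prop), hI1, lintegral_add_right _ (hg.const_mul _),
    lintegral_const_mul _ hg, hrad ρ hρ0, hI, ← ENNReal.ofReal_mul ht0] at hsum
  have hfinal := (ENNReal.add_le_add_iff_right ENNReal.ofReal_ne_top).1 hsum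
  rw [hI, ← ENNReal.ofReal_mul hlam.le, expNeg_ofReal (by positivity), ← ENNReal.ofReal_one,
    ← ENNReal.ofReal_sub _ (Real.exp_pos _).le, ← hρI]
  exact hfinal

/-! ### Measurability of the gains and integration over the marks -/

@[fun_prop]
lemma measurable_signalGain {M : ℕ} :
    Measurable fun p : (Fin M → ℂ) × (Fin M → ℂ) => signalGain p.1 p.2 := by
  unfold signalGain beam dotProduct
  fun_prop

@[fun_prop]
lemma measurable_noiseGain {M : ℕ} (V : NoisePrecoder M) :
    Measurable fun p : (Fin M → ℂ) × (Fin M → ℂ) => noiseGain V p.1 p.2 := by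
  unfold noiseGain Matrix.vecMul dotProduct
  have := V.measurable
  have h : ∀ i l, Measurable fun p : (Fin M → ℂ) × (Fin M → ℂ) => V.W p.1 i l :=
    fun i l => (this i l).comp measurable_fst
  fun_prop

/-- The precoder is constrained only at nonzero channels, so the zero channel has to be negligible.
-/
lemma channelLaw_ae_ne_zero {M : ℕ} (hM : 2 ≤ M) : ∀ᵐ h ∂(channelLaw M), h ≠ 0 := by
  obtain ⟨m, rfl⟩ : ∃ m, M = m + 1 := ⟨M - 1, by omega⟩
  have h1 := lintegral_sum_norm_sq_channelLaw m
    (F := ({0} : Set ℝ).indicator 1) (measurable_one.indicator (measurableSet_singleton 0))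
  have h2 : ∫⁻ t in Set.Ioi (0 : ℝ), ({0} : Set ℝ).indicator 1 t
      * ENNReal.ofReal (t ^ m / m.factorial * Real.exp (-t)) = 0 := by
    rw [setLIntegral_congr_fun (g := fun _ => 0) measurableSet_Ioi, lintegral_zero]
    intro t ht
    have : t ≠ 0 := ne_of_gt ht
    simp [this]
  rw [h2, lintegral_eq_zero_iff] at h1
  · filter_upwards [h1] with g hg h0
    subst h0
    simp at hg
  · exact (measurable_one.indicator (measurableSet_singleton (0 : ℝ))).comp
      (by fun_prop : Measurable fun g : Fin (m + 1) → ℂ => ∑ l, ‖g l‖ ^ 2)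

/-- The inner mean is the same for every nonzero `h`, so neither the law of the user channel nor the
choice of precoder affects the result. -/
lemma lintegral_servingLaw {M : ℕ} (hM : 2 ≤ M) (i : ℕ) {F : (Fin M → ℂ) → (Fin M → ℂ) → ℝ≥0∞}
    (hF : Measurable fun p : (Fin M → ℂ) × (Fin M → ℂ) => F p.1 p.2) {c : ℝ≥0∞}
    (hc : ∀ h, h ≠ 0 → ∫⁻ g, F h g ∂(channelLaw M) = c) :
    ∫⁻ s, F s.1 (s.2 i) ∂(servingLaw M) = c := by
  have hm : Measurable fun s : ServingMark M => F s.1 (s.2 i) :=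
    hF.comp (f := fun s : ServingMark M => (s.1, s.2 i)) (by fun_prop)
  rw [servingLaw, lintegral_prod _ hm.aemeasurable]
  have h1 : ∀ h, ∫⁻ g, F h (g i) ∂(Measure.infinitePi fun _ : ℕ => channelLaw M)
      = ∫⁻ g, F h g ∂(channelLaw M) := fun h =>
    (measurePreserving_eval_infinitePi (fun _ : ℕ => channelLaw M) i).lintegral_comp
      (f := fun g => F h g) (hF.comp (measurable_const.prodMk measurable_id))
  rw [lintegral_congr h1, lintegral_congr_ae
    ((channelLaw_ae_ne_zero hM).mono fun h hh => hc h hh)]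
  simp

/-! ### Interception probability given the locations -/

namespace Network

variable {K : ℕ} (net : Network K)

/-- Artificial noise received at distance `d` from a base station of tier `j` with marks `mk`. -/
def interf (j : Fin K) (V : NoisePrecoder (net.M j)) (i : ℕ) (d : ℝ) (mk : BSMark (net.M j)) : ℝ :=
  if mk.1 then
    (1 - net.phi j) * net.pow j * noiseGain V mk.2.1 (mk.2.2 i)
      / (((net.M j : ℝ) - 1) * d ^ net.alpha)
  else 0

/-- Mean of `e^{-a x}`, with `x` the artificial noise received at distance `d`. -/
def interfFactor (A : Fin K → unitInterval) (j : Fin K) (c d : ℝ) : ℝ :=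
  1 - (A j : ℝ)
    + A j * (1 + c * (net.xi j * net.phi j * net.pow j) / d ^ net.alpha)⁻¹ ^ (net.M j - 1)

lemma M_sub_one_pos (j : Fin K) : (0 : ℝ) < (net.M j : ℝ) - 1 := by
  have : (2 : ℝ) ≤ net.M j := by exact_mod_cast net.two_le_M j
  linarith

lemma xi_nonneg (j : Fin K) : 0 ≤ net.xi j :=
  div_nonneg (sub_nonneg.2 ((one_le_inv₀ (net.phi_pos j)).2 (net.phi_le_one j)))
    (net.M_sub_one_pos j).le

lemma xi_mul (j : Fin K) :
    net.xi j * net.phi j * net.pow j = (1 - net.phi j) * net.pow j / ((net.M j : ℝ) - 1) := by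
  have := (net.phi_pos j).ne'
  rw [xi]; field_simp

lemma xi_mul_nonneg (j : Fin K) : 0 ≤ net.xi j * net.phi j * net.pow j :=
  mul_nonneg (mul_nonneg (net.xi_nonneg j) (net.phi_pos j).le) (net.pow_pos j).le

lemma interfFactor_mem (A : Fin K → unitInterval) (j : Fin K) {c d : ℝ} (hc : 0 ≤ c)
    (hd : 0 ≤ d) : 0 ≤ net.interfFactor A j c d ∧ net.interfFactor A j c d ≤ 1 := by
  have hA0 := (A j).2.1
  have hA1 := (A j).2.2
  have hx := net.xi_mul_nonneg j
  have hdp : 0 ≤ d ^ net.alpha := Real.rpow_nonneg hd _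
  have h1 : 0 ≤ (1 + c * (net.xi j * net.phi j * net.pow j) / d ^ net.alpha)⁻¹ := by positivity
  have h2 : (1 + c * (net.xi j * net.phi j * net.pow j) / d ^ net.alpha)⁻¹ ≤ 1 :=
    inv_le_one_of_one_le₀ (by
      have : 0 ≤ c * (net.xi j * net.phi j * net.pow j) / d ^ net.alpha := by positivity
      linarith)
  have h3 := pow_le_one₀ (n := net.M j - 1) h1 h2
  have h4 := pow_nonneg h1 (net.M j - 1)
  unfold interfFactor
  constructor <;> nlinarith

lemma one_sub_interfFactor (A : Fin K → unitInterval) (j : Fin K) (c d : ℝ) :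
    1 - net.interfFactor A j c d = A j
      * (1 - (1 + c * (net.xi j * net.phi j * net.pow j) / d ^ net.alpha)⁻¹ ^ (net.M j - 1)) := by
  unfold interfFactor; ring

@[fun_prop]
lemma measurable_interf (j : Fin K) (V : NoisePrecoder (net.M j)) (i : ℕ) :
    Measurable fun p : ℝ × BSMark (net.M j) => net.interf j V i p.1 p.2 := by
  unfold interf
  have hn : Measurable fun p : ℝ × BSMark (net.M j) => noiseGain V p.2.2.1 (p.2.2.2 i) :=
    (measurable_noiseGain V).comp
      (f := fun p : ℝ × BSMark (net.M j) => (p.2.2.1, p.2.2.2 i)) (by fun_prop)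
  refine Measurable.ite ?_ (by fun_prop) measurable_const
  exact (measurable_fst.comp measurable_snd) (measurableSet_singleton true)

/-- An idle station contributes `1`, an active one the Gamma Laplace transform at `a`. At `d = 0`
division by zero makes both the interference and `a` vanish, so the identity persists. -/
lemma lintegral_expNeg_interf (A : Fin K → unitInterval) (j : Fin K)
    (V : NoisePrecoder (net.M j)) (i : ℕ) {c d : ℝ} (hc : 0 ≤ c) (hd : 0 ≤ d) :
    ∫⁻ mk, expNeg (ENNReal.ofReal c * ENNReal.ofReal (net.interf j V i d mk))
        ∂(bsLaw (A j) (net.M j))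
      = ENNReal.ofReal (net.interfFactor A j c d) := by
  have hx := net.xi_mul_nonneg j
  have hdp : 0 ≤ d ^ net.alpha := Real.rpow_nonneg hd _
  set a := c * (net.xi j * net.phi j * net.pow j) / d ^ net.alpha with ha
  have ha0 : 0 ≤ a := by positivity
  have hm : Measurable fun mk => expNeg (ENNReal.ofReal c
      * ENNReal.ofReal (net.interf j V i d mk)) := by
    have := (net.measurable_interf j V i).comp (measurable_const (a := d) |>.prodMk measurable_id)
    exact measurable_expNeg.comp (measurable_const.mul this.ennreal_ofReal)
  have htrue : ∫⁻ s, expNeg (ENNReal.ofReal c * ENNReal.ofReal (net.interf j V i d (true, s)))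
      ∂(servingLaw (net.M j)) = ENNReal.ofReal ((1 + a)⁻¹ ^ (net.M j - 1)) := by
    have h1 : ∀ s : ServingMark (net.M j), expNeg (ENNReal.ofReal c
        * ENNReal.ofReal (net.interf j V i d (true, s)))
        = (fun h g => expNeg (ENNReal.ofReal a * ENNReal.ofReal (noiseGain V h g)))
          s.1 (s.2 i) := by
      intro s
      simp only [interf, if_true]
      rw [← ENNReal.ofReal_mul hc, ← ENNReal.ofReal_mul ha0, ha, net.xi_mul]
      congr 2
      simp only [div_eq_mul_inv, mul_inv]
      ring
    rw [lintegral_congr h1]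
    exact lintegral_servingLaw (net.two_le_M j) i
      (F := fun h g => expNeg (ENNReal.ofReal a * ENNReal.ofReal (noiseGain V h g)))
      (measurable_expNeg.comp (measurable_const.mul (measurable_noiseGain V).ennreal_ofReal))
      (fun h hh => lintegral_expNeg_noiseGain (net.two_le_M j) V hh ha0)
  have hfalse : ∫⁻ s, expNeg (ENNReal.ofReal c * ENNReal.ofReal (net.interf j V i d (false, s)))
      ∂(servingLaw (net.M j)) = 1 := by
    simp [interf, expNeg_zero]
  rw [bsLaw, lintegral_prod _ hm.aemeasurable, bernoulliMeasure_def, lintegral_add_measure,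
    lintegral_smul_measure, lintegral_smul_measure, lintegral_dirac, lintegral_dirac, htrue, hfalse,
    interfFactor, ← ha]
  have hA0 := (A j).2.1
  have hA1 := (A j).2.2
  rw [ENNReal.ofReal_add (by linarith) (by positivity), ENNReal.ofReal_mul hA0, add_comm]
  congr 1
  · rw [ENNReal.smul_def, smul_eq_mul, mul_one, ← ENNReal.ofReal_coe_nnreal]; rfl
  · rw [ENNReal.smul_def, smul_eq_mul, ← ENNReal.ofReal_coe_nnreal]; rfl

/-- Received signal power at distance `d` from the serving base station. -/
def rxSignal (k : Fin K) (i : ℕ) (d : ℝ) (s : ServingMark (net.M k)) : ℝ :=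
  net.phi k * net.pow k * signalGain s.1 (s.2 i) / d ^ net.alpha

/-- Received artificial noise at distance `d` from the serving base station. -/
def rxNoise (k : Fin K) (V : NoisePrecoder (net.M k)) (i : ℕ) (d : ℝ)
    (s : ServingMark (net.M k)) : ℝ :=
  (1 - net.phi k) * net.pow k * noiseGain V s.1 (s.2 i) / (((net.M k : ℝ) - 1) * d ^ net.alpha)

/-- The SINR at `y` as a function of locations and marks. -/
def sinrAt (k : Fin K) (V : ∀ j, NoisePrecoder (net.M j)) (i : ℕ) (b : Plane)
    (x : Fin K → ℕ → Plane) (y : Plane) (mk : ∀ j, ℕ → BSMark (net.M j))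
    (s : ServingMark (net.M k)) : ℝ≥0∞ :=
  ENNReal.ofReal (net.rxSignal k i (dist b y) s) /
    (ENNReal.ofReal (net.rxNoise k (V k) i (dist b y) s)
      + ∑ j, ∑' n, ENNReal.ofReal (net.interf j (V j) i (dist (x j n) y) (mk j n))
      + ENNReal.ofReal net.N0)

/-- `β d^α / (φ_k P_k)`. -/
def scale (k : Fin K) (βe d : ℝ) : ℝ := βe * d ^ net.alpha / (net.phi k * net.pow k)

/-- Probability, given the locations, that the SINR at `y` is at least `βe`. -/
def outage (A : Fin K → unitInterval) (k : Fin K) (βe : ℝ) (b : Plane) (x : Fin K → ℕ → Plane)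
    (y : Plane) : ℝ≥0∞ :=
  if dist b y = 0 then 0 else
    ENNReal.ofReal ((1 + net.xi k * βe)⁻¹ ^ (net.M k - 1))
      * expNeg (ENNReal.ofReal (net.scale k βe (dist b y) * net.N0)
        + ∑ j, ∑' n, negLog (ENNReal.ofReal
          (net.interfFactor A j (net.scale k βe (dist b y)) (dist (x j n) y))))

lemma scale_nonneg (k : Fin K) {βe d : ℝ} (hβ : 0 ≤ βe) (hd : 0 ≤ d) : 0 ≤ net.scale k βe d := by
  have := net.phi_pos k
  have := net.pow_pos k
  have : 0 ≤ d ^ net.alpha := Real.rpow_nonneg hd _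
  unfold scale; positivity

/-- Law of the marks of all interfering base stations. -/
abbrev marksLaw (A : Fin K → unitInterval) : Measure (∀ j, ℕ → BSMark (net.M j)) :=
  Measure.pi fun j => Measure.infinitePi fun _ : ℕ => bsLaw (A j) (net.M j)

lemma measurable_rxSignal (k : Fin K) (i : ℕ) :
    Measurable fun p : ℝ × ServingMark (net.M k) => net.rxSignal k i p.1 p.2 := by
  have hn : Measurable fun p : ℝ × ServingMark (net.M k) => signalGain p.2.1 (p.2.2 i) :=
    measurable_signalGain.comp
      (f := fun p : ℝ × ServingMark (net.M k) => (p.2.1, p.2.2 i)) (by fun_prop)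
  unfold rxSignal; fun_prop

lemma measurable_rxNoise (k : Fin K) (V : NoisePrecoder (net.M k)) (i : ℕ) :
    Measurable fun p : ℝ × ServingMark (net.M k) => net.rxNoise k V i p.1 p.2 := by
  have hn : Measurable fun p : ℝ × ServingMark (net.M k) => noiseGain V p.2.1 (p.2.2 i) :=
    (measurable_noiseGain V).comp
      (f := fun p : ℝ × ServingMark (net.M k) => (p.2.1, p.2.2 i)) (by fun_prop)
  unfold rxNoise; fun_prop

/-- Configurations: locations of the base stations and of an eavesdropper, and marks. -/
abbrev Config (k : Fin K) : Type :=
  ((Fin K → ℕ → Plane) × Plane) × ((∀ j, ℕ → BSMark (net.M j)) × ServingMark (net.M k))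

lemma measurable_sinrAt (k : Fin K) (V : ∀ j, NoisePrecoder (net.M j)) (i : ℕ) (b : Plane) :
    Measurable fun p : net.Config k => net.sinrAt k V i b p.1.1 p.1.2 p.2.1 p.2.2 := by
  have h1 : Measurable fun p : net.Config k => net.rxSignal k i (dist b p.1.2) p.2.2 :=
    (net.measurable_rxSignal k i).comp
      (f := fun p : net.Config k => (dist b p.1.2, p.2.2)) (by fun_prop)
  have h2 : Measurable fun p : net.Config k => net.rxNoise k (V k) i (dist b p.1.2) p.2.2 :=
    (net.measurable_rxNoise k (V k) i).comp
      (f := fun p : net.Config k => (dist b p.1.2, p.2.2)) (by fun_prop)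
  have h3 : ∀ j n, Measurable fun p : net.Config k =>
      net.interf j (V j) i (dist (p.1.1 j n) p.1.2) (p.2.1 j n) := fun j n =>
    (net.measurable_interf j (V j) i).comp
      (f := fun p : net.Config k => (dist (p.1.1 j n) p.1.2, p.2.1 j n)) (by fun_prop)
  unfold sinrAt
  refine Measurable.div h1.ennreal_ofReal ((h2.ennreal_ofReal.add ?_).add measurable_const)
  exact Finset.measurable_fun_sum _ fun j _ => Measurable.tsum fun n => (h3 j n).ennreal_ofReal

lemma lintegral_expNeg_total_interf (A : Fin K → unitInterval) (V : ∀ j, NoisePrecoder (net.M j))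
    (i : ℕ) (x : Fin K → ℕ → Plane) (y : Plane) {c : ℝ} (hc : 0 ≤ c) :
    ∫⁻ mk, expNeg (ENNReal.ofReal c
        * ∑ j, ∑' n, ENNReal.ofReal (net.interf j (V j) i (dist (x j n) y) (mk j n)))
        ∂(net.marksLaw A)
      = expNeg (∑ j, ∑' n, negLog (ENNReal.ofReal (net.interfFactor A j c (dist (x j n) y)))) := by
  have hm : ∀ j n, Measurable fun mk : BSMark (net.M j) => ENNReal.ofReal c
      * ENNReal.ofReal (net.interf j (V j) i (dist (x j n) y) mk) := fun j n => by
    have := (net.measurable_interf j (V j) i).comp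
      (measurable_const (a := dist (x j n) y) |>.prodMk measurable_id)
    exact measurable_const.mul this.ennreal_ofReal
  have h1 : ∀ mk : ∀ j, ℕ → BSMark (net.M j), expNeg (ENNReal.ofReal c
        * ∑ j, ∑' n, ENNReal.ofReal (net.interf j (V j) i (dist (x j n) y) (mk j n)))
      = ∏ j, (fun (j : Fin K) (m : ℕ → BSMark (net.M j)) => expNeg (∑' n, ENNReal.ofReal c
        * ENNReal.ofReal (net.interf j (V j) i (dist (x j n) y) (m n)))) j (mk j) := by
    intro mk
    rw [← expNeg_sum, Finset.mul_sum]
    simp_rw [ENNReal.tsum_mul_left]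
  rw [lintegral_congr h1, marksLaw, lintegral_prod_pi (f := fun (j : Fin K)
    (m : ℕ → BSMark (net.M j)) => expNeg (∑' n, ENNReal.ofReal c
        * ENNReal.ofReal (net.interf j (V j) i (dist (x j n) y) (m n)))) _
    (fun j => measurable_expNeg.comp
    (Measurable.tsum fun n => (hm j n).comp (measurable_pi_apply n))), expNeg_sum]
  refine Finset.prod_congr rfl fun j _ => ?_
  rw [lintegral_expNeg_tsum_infinitePi (bsLaw (A j) (net.M j)) (hm j)]
  simp_rw [net.lintegral_expNeg_interf A j (V j) i hc dist_nonneg]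

/-- The conditional probability, given the locations, that the SINR is at least `βe`. -/
lemma lintegral_sinrAt_ge (hN : 0 < net.N0) (A : Fin K → unitInterval) (k : Fin K)
    (V : ∀ j, NoisePrecoder (net.M j)) (i : ℕ) (b : Plane) (x : Fin K → ℕ → Plane) (y : Plane)
    {βe : ℝ} (hβ : 0 < βe) :
    ((net.marksLaw A).prod (servingLaw (net.M k)))
        {m | ENNReal.ofReal βe ≤ net.sinrAt k V i b x y m.1 m.2}
      = net.outage A k βe b x y := by
  have hms : MeasurableSet {m : (∀ j, ℕ → BSMark (net.M j)) × ServingMark (net.M k) |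
      ENNReal.ofReal βe ≤ net.sinrAt k V i b x y m.1 m.2} :=
    measurableSet_le measurable_const ((net.measurable_sinrAt k V i b).comp
      (f := fun m : (∀ j, ℕ → BSMark (net.M j)) × ServingMark (net.M k) =>
        (((x, y), m) : net.Config k)) measurable_prodMk_left)
  have hα : 0 < net.alpha := by linarith [net.two_lt_alpha]
  have hφ := net.phi_pos k
  have hP := net.pow_pos k
  have hξ := net.xi_nonneg k
  have hM := net.M_sub_one_pos k
  unfold outage
  split_ifs with hd
  -- At distance zero, division by `0 ^ α = 0` makes the signal zero, so the threshold is never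
  -- reached.
  · have hempty : {m : (∀ j, ℕ → BSMark (net.M j)) × ServingMark (net.M k) |
        ENNReal.ofReal βe ≤ net.sinrAt k V i b x y m.1 m.2} = ∅ := by
      ext m
      simp [sinrAt, rxSignal, hd, Real.zero_rpow hα.ne', hβ]
    rw [hempty, measure_empty]
  have hd0 : 0 < dist b y := lt_of_le_of_ne dist_nonneg (Ne.symm hd)
  have hdp : 0 < dist b y ^ net.alpha := Real.rpow_pos_of_pos hd0 _
  set c := net.scale k βe (dist b y) with hc
  have hc0 : 0 ≤ c := net.scale_nonneg k hβ.le dist_nonneg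
  -- The received signal power per unit gain; dividing the SINR inequality by `κ` turns `β` into
  -- `c`.
  set κ := net.phi k * net.pow k / dist b y ^ net.alpha with hκ
  have hκ0 : 0 < κ := by positivity
  have hκc : κ * c = βe := by
    rw [hκ, hc, scale]; field_simp
  have hiff : ∀ (mk : ∀ j, ℕ → BSMark (net.M j)) (s : ServingMark (net.M k)),
      ENNReal.ofReal βe ≤ net.sinrAt k V i b x y mk s ↔
      ENNReal.ofReal (net.xi k * βe) * ENNReal.ofReal (noiseGain (V k) s.1 (s.2 i))
        + ENNReal.ofReal c * (∑ j, ∑' n, ENNReal.ofReal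
            (net.interf j (V j) i (dist (x j n) y) (mk j n)) + ENNReal.ofReal net.N0)
        ≤ ENNReal.ofReal (signalGain s.1 (s.2 i)) := by
    intro mk s
    unfold sinrAt
    set I := ∑ j, ∑' n, ENNReal.ofReal (net.interf j (V j) i (dist (x j n) y) (mk j n))
    -- Thermal noise keeps the denominator nonzero; it may still be infinite.
    rw [ENNReal.le_div_iff_mul_le (Or.inl (by simp [hN])) (Or.inr ENNReal.ofReal_ne_top)]
    have e1 : ENNReal.ofReal (net.rxSignal k i (dist b y) s)
        = ENNReal.ofReal κ * ENNReal.ofReal (signalGain s.1 (s.2 i)) := by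
      rw [← ENNReal.ofReal_mul hκ0.le, rxSignal, hκ]
      congr 1; ring
    have e2 : ENNReal.ofReal βe * (ENNReal.ofReal (net.rxNoise k (V k) i (dist b y) s) + I
          + ENNReal.ofReal net.N0)
        = ENNReal.ofReal κ * (ENNReal.ofReal (net.xi k * βe)
          * ENNReal.ofReal (noiseGain (V k) s.1 (s.2 i))
          + ENNReal.ofReal c * (I + ENNReal.ofReal net.N0)) := by
      rw [add_assoc, mul_add, mul_add (ENNReal.ofReal κ),
        ← mul_assoc (ENNReal.ofReal κ) (ENNReal.ofReal c),
        ← ENNReal.ofReal_mul hκ0.le, hκc]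
      congr 1
      rw [← ENNReal.ofReal_mul hβ.le, ← ENNReal.ofReal_mul (by positivity),
        ← ENNReal.ofReal_mul hκ0.le]
      congr 1
      rw [rxNoise, hκ, xi]
      field_simp
    rw [e1, e2, mul_comm, mul_comm (ENNReal.ofReal κ)]
    exact ENNReal.mul_le_mul_iff_left (by simpa using hκ0) ENNReal.ofReal_ne_top
  rw [Measure.prod_apply hms]
  -- With the interferers frozen, the tail formula applies with `a = ξβ` and `Y = c(I + N₀)`.
  have hin : ∀ mk : ∀ j, ℕ → BSMark (net.M j), servingLaw (net.M k) (Prod.mk mk ⁻¹'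
      {m | ENNReal.ofReal βe ≤ net.sinrAt k V i b x y m.1 m.2})
      = ENNReal.ofReal ((1 + net.xi k * βe)⁻¹ ^ (net.M k - 1))
        * (expNeg (ENNReal.ofReal (c * net.N0)) * expNeg (ENNReal.ofReal c * ∑ j, ∑' n,
          ENNReal.ofReal (net.interf j (V j) i (dist (x j n) y) (mk j n)))) := by
    intro mk
    set I := ∑ j, ∑' n, ENNReal.ofReal (net.interf j (V j) i (dist (x j n) y) (mk j n)) with hI
    have hS : MeasurableSet (Prod.mk mk ⁻¹'
      {m | ENNReal.ofReal βe ≤ net.sinrAt k V i b x y m.1 m.2}) := measurable_prodMk_left hms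
    rw [← lintegral_indicator_one hS, ← expNeg_add, ENNReal.ofReal_mul hc0,
      add_comm (ENNReal.ofReal c * ENNReal.ofReal net.N0), ← mul_add]
    have h1 : ∀ s, (Prod.mk mk ⁻¹'
        {m | ENNReal.ofReal βe ≤ net.sinrAt k V i b x y m.1 m.2}).indicator
        (1 : ServingMark (net.M k) → ℝ≥0∞) s
        = (fun h g => {p : ℝ × ℝ | ENNReal.ofReal (net.xi k * βe) * ENNReal.ofReal p.2
            + ENNReal.ofReal c * (I + ENNReal.ofReal net.N0) ≤ ENNReal.ofReal p.1}.indicator 1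
            (signalGain h g, noiseGain (V k) h g)) s.1 (s.2 i) := by
      intro s
      have := hiff mk s
      rw [← hI] at this
      simp only [Set.indicator, Set.mem_preimage, Set.mem_ofPred_eq, Pi.one_apply, this]
    rw [lintegral_congr h1]
    refine lintegral_servingLaw (net.two_le_M k) i ?_ fun h hh =>
      channelLaw_signalGain_ge (net.two_le_M k) (V k) hh (mul_nonneg hξ hβ.le) _
    have hms2 : MeasurableSet {p : ℝ × ℝ | ENNReal.ofReal (net.xi k * βe) * ENNReal.ofReal p.2
            + ENNReal.ofReal c * (I + ENNReal.ofReal net.N0) ≤ ENNReal.ofReal p.1} :=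
      measurableSet_le (by fun_prop) (by fun_prop)
    exact (measurable_one.indicator hms2).comp
      (measurable_signalGain.prodMk (measurable_noiseGain (V k)))
  rw [lintegral_congr hin, lintegral_const_mul' _ _ ENNReal.ofReal_ne_top,
    lintegral_const_mul' _ _ (expNeg_ne_top _), net.lintegral_expNeg_total_interf A V i x y hc0,
    ← expNeg_add]

end Network

/-! ### Averaging one tier over the plane -/

namespace Network

variable {K : ℕ} (net : Network K)

lemma outage_le_one (A : Fin K → unitInterval) (k : Fin K) {βe : ℝ} (hβ : 0 < βe) (b : Plane)
    (x : Fin K → ℕ → Plane) (y : Plane) : net.outage A k βe b x y ≤ 1 := by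
  have h : 0 ≤ net.xi k * βe := mul_nonneg (net.xi_nonneg k) hβ.le
  unfold outage
  split_ifs
  · exact zero_le_one
  · refine mul_le_one' ?_ (expNeg_le_one _)
    rw [ENNReal.ofReal_le_one]
    exact pow_le_one₀ (by positivity) (inv_le_one_of_one_le₀ (by linarith))

lemma measurable_outage (A : Fin K → unitInterval) (k : Fin K) (βe : ℝ) (b : Plane) :
    Measurable fun p : (Fin K → ℕ → Plane) × Plane => net.outage A k βe b p.1 p.2 := by
  unfold outage
  refine Measurable.ite ?_ measurable_const ?_
  · exact (by fun_prop : Measurable fun p : (Fin K → ℕ → Plane) × Plane => dist b p.2)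
      (measurableSet_singleton 0)
  · have h : ∀ j n, Measurable fun p : (Fin K → ℕ → Plane) × Plane => negLog (ENNReal.ofReal
          (net.interfFactor A j (net.scale k βe (dist b p.2)) (dist (p.1 j n) p.2))) := by
      intro j n
      unfold interfFactor scale
      fun_prop
    have h2 : Measurable fun p : (Fin K → ℕ → Plane) × Plane => ∑ j, ∑' n, negLog (ENNReal.ofReal
          (net.interfFactor A j (net.scale k βe (dist b p.2)) (dist (p.1 j n) p.2))) :=
      Finset.measurable_fun_sum _ fun j _ => Measurable.tsum fun n => h j n
    unfold scale at *
    fun_prop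

lemma delta_pos : 0 < net.delta := div_pos two_pos (by linarith [net.two_lt_alpha])

lemma delta_lt_one : net.delta < 1 := by
  have := net.two_lt_alpha
  rw [delta, div_lt_one (by linarith)]; exact this

lemma gammaConst_nonneg (j : Fin K) : 0 ≤ net.gammaConst (net.M j) := by
  have h1 := net.M_sub_one_pos j
  have h2 := net.delta_pos
  have h3 := net.delta_lt_one
  rw [delta] at h2 h3
  exact div_nonneg (mul_nonneg (Real.Gamma_pos_of_pos (by linarith)).le
    (Real.Gamma_pos_of_pos (by linarith)).le) (Real.Gamma_pos_of_pos h1).le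

lemma psi_term_nonneg (A : Fin K → unitInterval) (j : Fin K) {s : ℝ} (hs : 0 ≤ s) :
    0 ≤ (A j : ℝ) * net.lam j * net.gammaConst (net.M j) * s ^ net.delta :=
  mul_nonneg (mul_nonneg (mul_nonneg (A j).2.1 (net.lam_pos j).le) (net.gammaConst_nonneg j))
    (Real.rpow_nonneg hs _)

lemma psi_nonneg (A : Fin K → unitInterval) (k : Fin K) : 0 ≤ net.psi A k :=
  Finset.sum_nonneg fun j _ => net.psi_term_nonneg A j
    (mul_nonneg (mul_nonneg (net.xi_nonneg j)
      (div_nonneg (net.phi_pos j).le (net.phi_pos k).le))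
      (div_nonneg (net.pow_pos j).le (net.pow_pos k).le))

/-- With `r = d²` the path loss `d^α` is `r^{1/δ}`, so this is the Gamma path-loss integral of shape
`m + 1 = M_j - 1`. Random activity merely multiplies the density by `A_j`. -/
lemma lintegral_one_sub_interfFactor (A : Fin K → unitInterval) (j : Fin K) {c : ℝ} (hc : 0 ≤ c)
    (y : Plane) :
    ENNReal.ofReal (net.lam j)
        * ∫⁻ z, (1 - ENNReal.ofReal (net.interfFactor A j c (dist z y)))
      = ENNReal.ofReal (Real.pi * ((A j : ℝ) * net.lam j * net.gammaConst (net.M j)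
        * (c * (net.xi j * net.phi j * net.pow j)) ^ net.delta)) := by
  obtain ⟨m, hm⟩ : ∃ m, net.M j = m + 1 + 1 := ⟨net.M j - 2, by have := net.two_le_M j; omega⟩
  set s := c * (net.xi j * net.phi j * net.pow j) with hs
  have hs0 : 0 ≤ s := mul_nonneg hc (net.xi_mul_nonneg j)
  have hα : 0 < net.alpha := by linarith [net.two_lt_alpha]
  have hA := (A j).2.1
  have h1 : ∀ z, 1 - ENNReal.ofReal (net.interfFactor A j c (dist z y))
      = (fun r => ENNReal.ofReal (A j)
        * ENNReal.ofReal (1 - (1 + s / r ^ net.delta⁻¹)⁻¹ ^ (m + 1))) (dist y z ^ 2) := by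
    intro z
    simp only
    rw [← ENNReal.ofReal_one, ← ENNReal.ofReal_sub _ (net.interfFactor_mem A j hc dist_nonneg).1,
      one_sub_interfFactor, ENNReal.ofReal_mul hA, ← hs, hm, Nat.add_sub_cancel, dist_comm,
      ← Real.rpow_natCast (dist y z) 2, ← Real.rpow_mul dist_nonneg, delta, inv_div]
    congr 6
    push_cast; field_simp
  rw [lintegral_congr h1, lintegral_plane_dist_sq y (F := fun r => ENNReal.ofReal (A j)
    * ENNReal.ofReal (1 - (1 + s / r ^ net.delta⁻¹)⁻¹ ^ (m + 1))) (by fun_prop),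
    lintegral_const_mul _ (by fun_prop),
    lintegral_one_sub_gamma_pathloss m net.delta_pos net.delta_lt_one hs0,
    ← ENNReal.ofReal_mul hA, ← ENNReal.ofReal_mul Real.pi_pos.le,
    ← ENNReal.ofReal_mul (net.lam_pos j).le]
  congr 1
  rw [gammaConst, hm, delta]
  push_cast
  rw [add_sub_cancel_right]
  ring

/-- The factor `d^α` in `scale` is raised to the power `δ = 2/α`, which makes the interference
exponent proportional to `d²`. -/
lemma sum_psi_terms (A : Fin K → unitInterval) (k : Fin K) {βe d : ℝ} (hβ : 0 < βe) (hd : 0 < d) :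
    ∑ j, Real.pi * ((A j : ℝ) * net.lam j * net.gammaConst (net.M j)
        * (net.scale k βe d * (net.xi j * net.phi j * net.pow j)) ^ net.delta)
      = Real.pi * net.psi A k * βe ^ net.delta * d ^ 2 := by
  have hα : 0 < net.alpha := by linarith [net.two_lt_alpha]
  have hφ := net.phi_pos k
  have hP := net.pow_pos k
  rw [psi, Finset.mul_sum, Finset.sum_mul, Finset.sum_mul]
  refine Finset.sum_congr rfl fun j _ => ?_
  have hφj := net.phi_pos j
  have hPj := net.pow_pos j
  have hξ := net.xi_nonneg j
  have h1 : net.scale k βe d * (net.xi j * net.phi j * net.pow j)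
      = βe * d ^ net.alpha
        * (net.xi j * (net.phi j / net.phi k) * (net.pow j / net.pow k)) := by
    rw [scale]; field_simp
  have h2 : (d ^ net.alpha) ^ net.delta = d ^ 2 := by
    rw [← Real.rpow_mul hd.le, delta, mul_div_cancel₀ _ hα.ne', ← Real.rpow_natCast]
    norm_num
  have hdp : 0 < d ^ net.alpha := Real.rpow_pos_of_pos hd _
  rw [h1, Real.mul_rpow (by positivity) (by positivity), Real.mul_rpow hβ.le hdp.le, h2]
  ring

/-- The exponent in the mean outage probability at squared distance `r`. -/
def meanExp (A : Fin K → unitInterval) (k : Fin K) (βe r : ℝ) : ℝ :=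
  βe * net.N0 / (net.phi k * net.pow k) * r ^ (net.alpha / 2)
    + Real.pi * net.psi A k * βe ^ net.delta * r

@[fun_prop]
lemma measurable_meanExp (A : Fin K → unitInterval) (k : Fin K) (βe : ℝ) :
    Measurable (net.meanExp A k βe) := by
  unfold meanExp; fun_prop

/-- The thermal-noise term alone gives integrability, so `ψ = 0` is allowed. -/
lemma integrableOn_meanExp (hN : 0 < net.N0) (A : Fin K → unitInterval) (k : Fin K) {βe : ℝ}
    (hβ : 0 < βe) : IntegrableOn (fun r => Real.exp (-net.meanExp A k βe r)) (Set.Ioi 0) := by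
  have hφ := net.phi_pos k
  have hP := net.pow_pos k
  have hψ := net.psi_nonneg A k
  have hα := net.two_lt_alpha
  have h := integrableOn_rpow_mul_exp_neg_mul_rpow (s := 0) (p := net.alpha / 2)
    (b := βe * net.N0 / (net.phi k * net.pow k)) (by norm_num) (by linarith) (by positivity)
  refine Integrable.mono' h (by fun_prop) ((ae_restrict_iff' measurableSet_Ioi).2
    (Filter.Eventually.of_forall fun r hr => ?_))
  have hr0 : (0 : ℝ) < r := hr
  rw [Real.norm_of_nonneg (Real.exp_pos _).le, Real.rpow_zero, one_mul, Real.exp_le_exp, meanExp]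
  have : 0 ≤ Real.pi * net.psi A k * βe ^ net.delta * r := by positivity
  linarith

end Network

/-! ### The secrecy probability and its two bounds -/

namespace Deployment

variable {K : ℕ} {net : Network K} {A : Fin K → unitInterval} {k : Fin K}
  {Ω : Type*} [MeasurableSpace Ω] {P : Measure Ω}

/-- Locations of the interfering base stations. -/
def bsLoc (D : Deployment net A k P) (ω : Ω) : Fin K → ℕ → Plane := fun j n => D.bs j n ω

/-- Locations of the eavesdroppers. -/
def eveLoc (D : Deployment net A k P) (ω : Ω) : ℕ → Plane := fun n => D.eve n ω

/-- Marks of all base stations. -/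
def marks (D : Deployment net A k P) (ω : Ω) :
    (∀ j, ℕ → BSMark (net.M j)) × ServingMark (net.M k) :=
  (fun j n => D.mark j n ω, D.serving ω)

lemma measurable_bsLoc (D : Deployment net A k P) : Measurable D.bsLoc :=
  measurable_pi_lambda _ fun j => measurable_pi_lambda _ fun n => (D.bs_poisson j).measurable n

lemma measurable_eveLoc (D : Deployment net A k P) : Measurable D.eveLoc :=
  measurable_pi_lambda _ fun n => D.eve_poisson.measurable n

lemma measurable_marks (D : Deployment net A k P) : Measurable D.marks :=
  (measurable_pi_lambda _ fun j => measurable_pi_lambda _ fun n => D.mark_measurable j n).prodMk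
    D.serving_measurable

/-- Marks are independent of locations, so conditioning freezes the locations and integrates over
the law of the marks. -/
lemma condProb_sinr_lt [IsProbabilityMeasure P] (hN : 0 < net.N0) (D : Deployment net A k P)
    {βe : ℝ} (hβ : 0 < βe) (i : ℕ) :
    P⟦{ω' | D.sinr i ω' < ENNReal.ofReal βe} | D.locations⟧
      =ᵐ[P] fun ω => (1 - net.outage A k βe D.b (D.bsLoc ω) (D.eve i ω)).toReal := by
  let S : Set (((Fin K → ℕ → Plane) × (ℕ → Plane))
      × ((∀ j, ℕ → BSMark (net.M j)) × ServingMark (net.M k))) :=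
    {p | net.sinrAt k D.precoder i D.b p.1.1 (p.1.2 i) p.2.1 p.2.2 < ENNReal.ofReal βe}
  have hS : MeasurableSet S := measurableSet_lt ((net.measurable_sinrAt k D.precoder i D.b).comp
    (f := fun p : ((Fin K → ℕ → Plane) × (ℕ → Plane))
      × ((∀ j, ℕ → BSMark (net.M j)) × ServingMark (net.M k)) =>
      (((p.1.1, p.1.2 i), p.2) : net.Config k)) (by fun_prop)) measurable_const
  have h := condProb_of_indepFun (D.measurable_bsLoc.prodMk D.measurable_eveLoc)
    D.measurable_marks D.marks_indep hS
  refine h.trans (Filter.Eventually.of_forall fun ω => ?_)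
  have hlaw : P.map D.marks = (net.marksLaw A).prod (servingLaw (net.M k)) := D.marks_law.map_eq
  have hset : Prod.mk (D.bsLoc ω, D.eveLoc ω) ⁻¹' S
      = {m | ENNReal.ofReal βe
          ≤ net.sinrAt k D.precoder i D.b (D.bsLoc ω) (D.eve i ω) m.1 m.2}ᶜ := by
    ext m
    simp only [S, Set.mem_preimage, Set.mem_ofPred_eq, Set.mem_compl_iff, not_le]
    rfl
  have hms : MeasurableSet {m : (∀ j, ℕ → BSMark (net.M j)) × ServingMark (net.M k) |
      ENNReal.ofReal βe ≤ net.sinrAt k D.precoder i D.b (D.bsLoc ω) (D.eve i ω) m.1 m.2} :=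
    measurableSet_le measurable_const ((net.measurable_sinrAt k D.precoder i D.b).comp
      (f := fun m : (∀ j, ℕ → BSMark (net.M j)) × ServingMark (net.M k) =>
        (((D.bsLoc ω, D.eve i ω), m) : net.Config k)) measurable_prodMk_left)
  simp only
  rw [hlaw, hset, prob_compl_eq_one_sub hms, net.lintegral_sinrAt_ge hN A k D.precoder i D.b _ _ hβ]

lemma indepFun_bsLoc_eveLoc (D : Deployment net A k P) : IndepFun D.bsLoc D.eveLoc P := by
  classical
  have hmeas : ∀ o : Option (Fin K), Measurable
      (fun ω (n : ℕ) => o.elim (D.eve n ω) fun j => D.bs j n ω) := by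
    intro o
    refine measurable_pi_lambda _ fun n => ?_
    cases o with
    | none => exact D.eve_poisson.measurable n
    | some j => exact (D.bs_poisson j).measurable n
  have h := D.points_indep.indepFun_finset (Finset.univ.erase none) {none}
    (by simp) hmeas
  have hφ : Measurable fun (f : (Finset.univ.erase (none : Option (Fin K)) : Finset _) → ℕ → Plane)
      (j : Fin K) => f ⟨some j, by simp⟩ := by fun_prop
  have hψ : Measurable fun (f : ({none} : Finset (Option (Fin K))) → ℕ → Plane) =>
      f ⟨none, Finset.mem_singleton_self none⟩ :=
    measurable_pi_apply
      (⟨none, Finset.mem_singleton_self none⟩ : ({none} : Finset (Option (Fin K))))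
  exact h.comp hφ hψ

lemma iIndepFun_bs (D : Deployment net A k P) :
    iIndepFun (fun (j : Fin K) ω (n : ℕ) => D.bs j n ω) P :=
  D.points_indep.precomp (g := (some : Fin K → Option (Fin K))) (Option.some_injective _)

/-- The secrecy probability, averaged over the eavesdroppers. -/
lemma secrecyProb_eq [IsProbabilityMeasure P] (hN : 0 < net.N0) (D : Deployment net A k P)
    {βe : ℝ} (hβ : 0 < βe) :
    D.secrecyProb βe = (∫⁻ ω, expNeg (ENNReal.ofReal net.lamE
      * ∫⁻ y, net.outage A k βe D.b (D.bsLoc ω) y) ∂P).toReal := by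
  have hg := net.measurable_outage A k βe D.b
  have hg1 := net.outage_le_one A k hβ D.b
  -- Chosen so that `e^{-f} = 1 - outage`: the product over eavesdroppers becomes `e^{-Σ f}`, and `1
  -- - e^{-f}` in the Laplace functional is again `outage`.
  let f : (Fin K → ℕ → Plane) → Plane → ℝ≥0∞ := fun x y =>
    negLog (1 - net.outage A k βe D.b x y)
  have hf : Measurable fun p : (Fin K → ℕ → Plane) × Plane => f p.1 p.2 := by
    fun_prop
  have hexp : ∀ x y, expNeg (f x y) = 1 - net.outage A k βe D.b x y := fun x y =>
    expNeg_negLog tsub_le_self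
  have h1 : (fun ω => ∏' i : ℕ, (P⟦{ω' | D.sinr i ω' < ENNReal.ofReal βe} | D.locations⟧) ω)
      =ᵐ[P] fun ω => (expNeg (∑' i, f (D.bsLoc ω) (D.eve i ω))).toReal := by
    filter_upwards [ae_all_iff.2 fun i => D.condProb_sinr_lt hN hβ i] with ω hω
    rw [← tprod_toReal_expNeg]
    refine tprod_congr fun i => ?_
    rw [hω i, hexp]
  have hmF : Measurable fun p : (Fin K → ℕ → Plane) × (ℕ → Plane) =>
      expNeg (∑' i, f p.1 (p.2 i)) := by
    refine measurable_expNeg.comp (Measurable.tsum fun i => ?_)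
    exact hf.comp (f := fun p : (Fin K → ℕ → Plane) × (ℕ → Plane) => (p.1, p.2 i)) (by fun_prop)
  rw [secrecyProb, integral_congr_ae h1, integral_toReal
    (f := fun ω => expNeg (∑' i, f (D.bsLoc ω) (D.eve i ω)))
    (hmF.comp (D.measurable_bsLoc.prodMk D.measurable_eveLoc)).aemeasurable
    (Filter.Eventually.of_forall fun ω => (expNeg_ne_top _).lt_top)]
  congr 1
  have h2 : ∫⁻ ω, expNeg (∑' i, f (D.bsLoc ω) (D.eve i ω)) ∂P
      = ∫⁻ p, expNeg (∑' i, f p.1 (p.2 i)) ∂(P.map fun ω => (D.bsLoc ω, D.eveLoc ω)) :=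
    (lintegral_map hmF (D.measurable_bsLoc.prodMk D.measurable_eveLoc)).symm
  have := Measure.isProbabilityMeasure_map (μ := P) D.measurable_eveLoc.aemeasurable
  have := Measure.isProbabilityMeasure_map (μ := P) D.measurable_bsLoc.aemeasurable
  -- Base stations and eavesdroppers are independent, so the former can be held fixed while the
  -- Laplace functional of the latter is applied.
  rw [h2, (indepFun_iff_map_prod_eq_prod_map_map D.measurable_bsLoc.aemeasurable
    D.measurable_eveLoc.aemeasurable).1 D.indepFun_bsLoc_eveLoc, lintegral_prod _ hmF.aemeasurable]
  have h3 : ∀ x, ∫⁻ y, expNeg (∑' i, f x (y i)) ∂(P.map D.eveLoc)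
      = expNeg (ENNReal.ofReal net.lamE * ∫⁻ y, net.outage A k βe D.b x y) := by
    intro x
    have hfx : Measurable (f x) := hf.comp (f := fun y => (x, y)) measurable_prodMk_left
    have hmFx : Measurable fun y : ℕ → Plane => expNeg (∑' i, f x (y i)) :=
      hmF.comp (f := fun y : ℕ → Plane => (x, y)) measurable_prodMk_left
    rw [lintegral_map hmFx D.measurable_eveLoc]
    have := D.eve_poisson.laplace hfx
    simp_rw [hexp, ENNReal.sub_sub_cancel ENNReal.one_ne_top (hg1 x _)] at this
    exact this
  simp only [h3]
  rw [lintegral_map _ D.measurable_bsLoc]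
  exact measurable_expNeg.comp (measurable_const.mul hg.lintegral_prod_right')

/-- The mean outage probability of an eavesdropper at `y`. -/
lemma lintegral_outage [IsProbabilityMeasure P] (D : Deployment net A k P) {βe : ℝ} (hβ : 0 < βe)
    {y : Plane} (hy : dist D.b y ≠ 0) :
    ∫⁻ ω, net.outage A k βe D.b (D.bsLoc ω) y ∂P
      = ENNReal.ofReal ((1 + net.xi k * βe)⁻¹ ^ (net.M k - 1))
        * ENNReal.ofReal (Real.exp (-net.meanExp A k βe (dist D.b y ^ 2))) := by
  have hd0 : 0 < dist D.b y := lt_of_le_of_ne dist_nonneg (Ne.symm hy)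
  set c := net.scale k βe (dist D.b y) with hc
  have hc0 : 0 ≤ c := net.scale_nonneg k hβ.le dist_nonneg
  have hf : ∀ j, Measurable fun z : Plane =>
      negLog (ENNReal.ofReal (net.interfFactor A j c (dist z y))) := by
    intro j
    unfold Network.interfFactor
    fun_prop
  have hle : ∀ j (z : Plane), ENNReal.ofReal (net.interfFactor A j c (dist z y)) ≤ 1 := by
    intro j z
    rw [ENNReal.ofReal_le_one]
    exact (net.interfFactor_mem A j hc0 dist_nonneg).2
  have hm : ∀ j, Measurable fun x : ℕ → Plane => expNeg (∑' n, negLog (ENNReal.ofReal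
      (net.interfFactor A j c (dist (x n) y)))) := fun j =>
    measurable_expNeg.comp (Measurable.tsum fun n => (hf j).comp (measurable_pi_apply n))
  have h1 : ∀ ω, net.outage A k βe D.b (D.bsLoc ω) y
      = ENNReal.ofReal ((1 + net.xi k * βe)⁻¹ ^ (net.M k - 1)) * (expNeg
        (ENNReal.ofReal (c * net.N0)) * ∏ j, expNeg (∑' n, negLog (ENNReal.ofReal
        (net.interfFactor A j c (dist (D.bs j n ω) y))))) := by
    intro ω
    rw [Network.outage, if_neg hy, expNeg_add, expNeg_sum]
    rfl
  have hind : iIndepFun (fun j ω => expNeg (∑' n, negLog (ENNReal.ofReal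
        (net.interfFactor A j c (dist (D.bs j n ω) y))))) P :=
    D.iIndepFun_bs.comp (fun j x => expNeg (∑' n, negLog (ENNReal.ofReal
      (net.interfFactor A j c (dist (x n) y))))) hm
  have hmω : ∀ j, Measurable fun ω => expNeg (∑' n, negLog (ENNReal.ofReal
        (net.interfFactor A j c (dist (D.bs j n ω) y)))) := fun j =>
    (hm j).comp (measurable_pi_lambda _ fun n => (D.bs_poisson j).measurable n)
  rw [lintegral_congr h1, lintegral_const_mul' _ _ ENNReal.ofReal_ne_top,
    lintegral_const_mul' _ _ (expNeg_ne_top _),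
    lintegral_prod_eq_prod_lintegral_of_indepFun _ _ hind hmω]
  -- The Laplace functional of tier `j` at `f = -log(interfFactor)`.
  have h2 : ∀ j, ∫⁻ ω, expNeg (∑' n, negLog (ENNReal.ofReal
        (net.interfFactor A j c (dist (D.bs j n ω) y)))) ∂P
      = expNeg (ENNReal.ofReal (Real.pi * ((A j : ℝ) * net.lam j * net.gammaConst (net.M j)
        * (c * (net.xi j * net.phi j * net.pow j)) ^ net.delta))) := by
    intro j
    rw [(D.bs_poisson j).laplace (hf j), ← net.lintegral_one_sub_interfFactor A j hc0 y]
    simp_rw [expNeg_negLog (hle j _)]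
  have hnn : ∀ j, 0 ≤ Real.pi * ((A j : ℝ) * net.lam j * net.gammaConst (net.M j)
        * (c * (net.xi j * net.phi j * net.pow j)) ^ net.delta) := fun j =>
    mul_nonneg Real.pi_pos.le (net.psi_term_nonneg A j (mul_nonneg hc0 (net.xi_mul_nonneg j)))
  have hsum := net.sum_psi_terms A k hβ hd0
  rw [← hc] at hsum
  rw [Finset.prod_congr rfl fun j _ => h2 j, ← expNeg_sum,
    ← ENNReal.ofReal_sum_of_nonneg fun j _ => hnn j, hsum, ← expNeg_add,
    ← ENNReal.ofReal_add (mul_nonneg hc0 net.N0_nonneg)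
      (hsum ▸ Finset.sum_nonneg fun j _ => hnn j), expNeg_ofReal (add_nonneg
        (mul_nonneg hc0 net.N0_nonneg) (hsum ▸ Finset.sum_nonneg fun j _ => hnn j))]
  congr 4
  rw [Network.meanExp, hc, Network.scale]
  congr 1
  rw [← Real.rpow_natCast (dist D.b y) 2, ← Real.rpow_mul dist_nonneg]
  push_cast
  rw [mul_div_cancel₀ _ (two_ne_zero' ℝ)]
  ring

/-- The weight is `1` for the lower bound and the density of the nearest eavesdropper for the upper
one. The point `y = b`, where `outage` is `0` by convention, is a null set. -/
lemma lintegral_weighted_outage [IsProbabilityMeasure P] (D : Deployment net A k P) {βe : ℝ}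
    (hβ : 0 < βe) {w : ℝ → ℝ≥0∞} (hw : Measurable w) :
    ∫⁻ ω, (∫⁻ y, w (dist D.b y ^ 2) * net.outage A k βe D.b (D.bsLoc ω) y) ∂P
      = ENNReal.ofReal ((1 + net.xi k * βe)⁻¹ ^ (net.M k - 1)) * (ENNReal.ofReal Real.pi
        * ∫⁻ r in Set.Ioi (0 : ℝ), w r * ENNReal.ofReal (Real.exp (-net.meanExp A k βe r))) := by
  have hg : Measurable fun p : Ω × Plane => net.outage A k βe D.b (D.bsLoc p.1) p.2 :=
    (net.measurable_outage A k βe D.b).comp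
      (f := fun p : Ω × Plane => (D.bsLoc p.1, p.2))
      ((D.measurable_bsLoc.comp measurable_fst).prodMk measurable_snd)
  rw [lintegral_lintegral_swap (Measurable.aemeasurable (by fun_prop))]
  have h1 : ∀ᵐ y ∂(volume : Measure Plane), ∫⁻ ω, w (dist D.b y ^ 2)
      * net.outage A k βe D.b (D.bsLoc ω) y ∂P
      = (fun r => ENNReal.ofReal ((1 + net.xi k * βe)⁻¹ ^ (net.M k - 1)) * (w r
        * ENNReal.ofReal (Real.exp (-net.meanExp A k βe r)))) (dist D.b y ^ 2) := by
    have h0 : ∀ᵐ y ∂(volume : Measure Plane), y ≠ D.b := by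
      rw [ae_iff]; simp
    filter_upwards [h0] with y hy
    have hgy : Measurable fun ω => net.outage A k βe D.b (D.bsLoc ω) y :=
      hg.comp (f := fun ω => (ω, y)) measurable_prodMk_right
    rw [lintegral_const_mul _ hgy, D.lintegral_outage hβ (by simpa [dist_eq_zero] using hy.symm)]
    ring
  rw [lintegral_congr_ae h1, lintegral_plane_dist_sq D.b (F := fun r =>
    ENNReal.ofReal ((1 + net.xi k * βe)⁻¹ ^ (net.M k - 1)) * (w r
      * ENNReal.ofReal (Real.exp (-net.meanExp A k βe r)))) (by fun_prop),
    lintegral_const_mul _ (by fun_prop)]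
  ring

theorem secrecyProb_bounds [IsProbabilityMeasure P] (hN : 0 < net.N0) (D : Deployment net A k P)
    {βe : ℝ} (hβ : 0 < βe) :
    net.lowerIntegral A k βe ≤ D.secrecyProb βe ∧ D.secrecyProb βe ≤ net.upperIntegral A k βe := by
  have hpi := Real.pi_pos
  have hlE := net.lamE_pos
  have hξ : 0 ≤ net.xi k * βe := mul_nonneg (net.xi_nonneg k) hβ.le
  have hmg : Measurable fun p : Ω × Plane => net.outage A k βe D.b (D.bsLoc p.1) p.2 :=
    (net.measurable_outage A k βe D.b).comp
      (f := fun p : Ω × Plane => (D.bsLoc p.1, p.2))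
      ((D.measurable_bsLoc.comp measurable_fst).prodMk measurable_snd)
  have hmH : Measurable fun ω => ∫⁻ y, net.outage A k βe D.b (D.bsLoc ω) y :=
    hmg.lintegral_prod_right'
  have hint := net.integrableOn_meanExp hN A k hβ
  have hfin : ∫⁻ ω, expNeg (ENNReal.ofReal net.lamE
      * ∫⁻ y, net.outage A k βe D.b (D.bsLoc ω) y) ∂P ≤ 1 :=
    (lintegral_mono fun ω => expNeg_le_one _).trans (by simp)
  rw [D.secrecyProb_eq hN hβ]
  constructor
  · have h1 := expNeg_lintegral_le (P := P) (hmH.const_mul (ENNReal.ofReal net.lamE))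
    have h2 := D.lintegral_weighted_outage hβ (w := fun _ => 1) measurable_const
    simp only [one_mul] at h2
    rw [lintegral_const_mul _ hmH, h2, ← ofReal_integral_eq_lintegral_ofReal hint
      (Filter.Eventually.of_forall fun r => (Real.exp_pos _).le),
      ← ENNReal.ofReal_mul hpi.le, ← ENNReal.ofReal_mul (by positivity),
      ← ENNReal.ofReal_mul hlE.le, expNeg_ofReal] at h1
    · have h3 := ENNReal.toReal_mono (hfin.trans_lt ENNReal.one_lt_top).ne h1
      rw [ENNReal.toReal_ofReal (Real.exp_pos _).le] at h3
      refine le_trans (le_of_eq ?_) h3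
      rw [Network.lowerIntegral]
      congr 2
      have h4 : ∀ r, -(βe * net.N0 / (net.phi k * net.pow k)) * r ^ (net.alpha / 2)
          - Real.pi * net.psi A k * βe ^ net.delta * r = -net.meanExp A k βe r := by
        intro r; rw [Network.meanExp]; ring
      simp_rw [h4]
      rw [inv_pow]
      ring
    · have : 0 ≤ ∫ r in Set.Ioi (0 : ℝ), Real.exp (-net.meanExp A k βe r) :=
        integral_nonneg fun r => (Real.exp_pos _).le
      positivity
  · have hw : Measurable fun r : ℝ =>
        ENNReal.ofReal (net.lamE * Real.exp (-(net.lamE * Real.pi * r))) := by fun_prop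
    -- The nearest-point inequality for each configuration of base stations, in additive form so
    -- that it can be integrated in `[0, ∞]`.
    have hpt : ∀ ω, expNeg (ENNReal.ofReal net.lamE
        * ∫⁻ y, net.outage A k βe D.b (D.bsLoc ω) y)
        + ∫⁻ y, ENNReal.ofReal (net.lamE * Real.exp (-(net.lamE * Real.pi * dist D.b y ^ 2)))
          * net.outage A k βe D.b (D.bsLoc ω) y ≤ 1 := by
      intro ω
      rw [add_comm]
      exact add_le_of_le_tsub_right_of_le (expNeg_le_one _) (lintegral_nearest_le hlE D.b
        (hmg.comp (f := fun y => (ω, y)) measurable_prodMk_left)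
        (net.outage_le_one A k hβ D.b (D.bsLoc ω)))
    have h1 := lintegral_mono (μ := P) hpt
    rw [lintegral_add_left (by fun_prop), D.lintegral_weighted_outage hβ hw] at h1
    set Z := ∫ r in Set.Ioi (0 : ℝ), Real.exp (-net.meanExp A k βe r - net.lamE * Real.pi * r)
      with hZ
    have hZ0 : 0 ≤ Z := integral_nonneg fun r => (Real.exp_pos _).le
    have h2 : ∫⁻ r in Set.Ioi (0 : ℝ),
        ENNReal.ofReal (net.lamE * Real.exp (-(net.lamE * Real.pi * r)))
          * ENNReal.ofReal (Real.exp (-net.meanExp A k βe r))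
        = ENNReal.ofReal (net.lamE * Z) := by
      rw [ENNReal.ofReal_mul hlE.le, hZ, ofReal_integral_eq_lintegral_ofReal,
        ← lintegral_const_mul _ (by fun_prop)]
      · refine lintegral_congr fun r => ?_
        rw [ENNReal.ofReal_mul hlE.le, mul_assoc, ← ENNReal.ofReal_mul (Real.exp_pos _).le,
          ← Real.exp_add]
        congr 3; ring
      · refine Integrable.mono' hint (by fun_prop) ((ae_restrict_iff' measurableSet_Ioi).2
          (Filter.Eventually.of_forall fun r hr => ?_))
        have hr0 : (0 : ℝ) < r := hr
        rw [Real.norm_of_nonneg (Real.exp_pos _).le, Real.exp_le_exp]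
        have : 0 ≤ net.lamE * Real.pi * r := by positivity
        linarith
      · exact Filter.Eventually.of_forall fun r => (Real.exp_pos _).le
    rw [h2, ← ENNReal.ofReal_mul hpi.le, ← ENNReal.ofReal_mul (by positivity)] at h1
    have h3 := ENNReal.toReal_mono (by simp) h1
    rw [ENNReal.toReal_add (hfin.trans_lt ENNReal.one_lt_top).ne ENNReal.ofReal_ne_top,
      ENNReal.toReal_ofReal (by positivity)] at h3
    simp only [lintegral_const, measure_univ, mul_one, ENNReal.toReal_one] at h3
    rw [Network.upperIntegral]
    have h4 : ∀ r, -(βe * net.N0 / (net.phi k * net.pow k)) * r ^ (net.alpha / 2)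
          - Real.pi * net.psi A k * βe ^ net.delta * r - Real.pi * net.lamE * r
          = -net.meanExp A k βe r - net.lamE * Real.pi * r := by
      intro r; rw [Network.meanExp]; ring
    simp_rw [h4]
    rw [← hZ]
    have h5 : (1 + net.xi k * βe)⁻¹ ^ (net.M k - 1) * (Real.pi * (net.lamE * Z))
        = Real.pi * net.lamE / (1 + net.xi k * βe) ^ (net.M k - 1) * Z := by
      rw [inv_pow]; ring
    rw [h5] at h3
    linarith

end Deployment

/-! ### Closed forms -/

lemma integrable_exp_neg_sq : Integrable fun s : ℝ => Real.exp (-s ^ 2) := by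
  simpa using integrable_exp_neg_mul_sq one_pos

/-- Substituting `t = s²` shows that `Omega` is the error function on `[0, ∞)`. Since it depends
only on `x²`, the identity needs `x ≥ 0`. -/
lemma one_sub_Omega {x : ℝ} (hx : 0 ≤ x) :
    Real.sqrt Real.pi / 2 * (1 - Omega x) = ∫ s in Set.Ioi x, Real.exp (-s ^ 2) := by
  have himg : (fun s : ℝ => s ^ 2) '' Set.Ioc 0 x = Set.Ioc 0 (x ^ 2) := by
    ext t
    constructor
    · rintro ⟨s, hs, rfl⟩
      exact ⟨pow_pos hs.1 2, pow_le_pow_left₀ hs.1.le hs.2 2⟩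
    · intro ht
      exact ⟨Real.sqrt t, ⟨Real.sqrt_pos.2 ht.1, (Real.sqrt_le_left hx).2 ht.2⟩,
        Real.sq_sqrt ht.1.le⟩
  have hsub : ∫ t in (0 : ℝ)..x ^ 2, Real.exp (-t) / Real.sqrt t
      = 2 * ∫ s in (0 : ℝ)..x, Real.exp (-s ^ 2) := by
    rw [intervalIntegral.integral_of_le (by positivity), ← himg,
      integral_image_eq_integral_abs_deriv_smul (f' := fun s => 2 * s) measurableSet_Ioc
        (fun s _ => by simpa using (hasDerivAt_pow 2 s).hasDerivWithinAt)
        (fun s hs t ht h => (pow_left_inj₀ hs.1.le ht.1.le two_ne_zero).1 h),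
      intervalIntegral.integral_of_le hx, ← integral_const_mul]
    refine setIntegral_congr_fun measurableSet_Ioc fun s hs => ?_
    have hs0 := hs.1
    simp only [smul_eq_mul]
    rw [Real.sqrt_sq hs0.le, abs_of_pos (by positivity)]
    field_simp
  have hadd := intervalIntegral.integral_interval_add_Ioi (a := (0 : ℝ)) (b := x)
    integrable_exp_neg_sq.integrableOn integrable_exp_neg_sq.integrableOn
  have hg := integral_gaussian_Ioi 1
  simp only [neg_mul, one_mul, div_one] at hg
  rw [hg] at hadd
  have hpi : 0 < Real.sqrt Real.pi := Real.sqrt_pos.2 Real.pi_pos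
  rw [Omega, hsub, eq_sub_of_add_eq' hadd]
  field_simp

/-- Completing the square, `a r² + b r = (√a r + c)² - c²` with `c = b / (2√a)`; scaling and
translation then reduce to the Gaussian tail beyond `c`. -/
lemma integral_exp_neg_quadratic {a b : ℝ} (ha : 0 < a) (hb : 0 ≤ b) :
    ∫ r in Set.Ioi (0 : ℝ), Real.exp (-a * r ^ (2 : ℝ) - b * r)
      = Real.exp (b ^ 2 / (4 * a)) * ((Real.sqrt a)⁻¹
        * (Real.sqrt Real.pi / 2 * (1 - Omega (b / (2 * Real.sqrt a))))) := by
  have hs : 0 < Real.sqrt a := Real.sqrt_pos.2 ha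
  have hsq : Real.sqrt a ^ 2 = a := Real.sq_sqrt ha.le
  set c := b / (2 * Real.sqrt a) with hc
  have hc0 : 0 ≤ c := by positivity
  rw [one_sub_Omega hc0]
  have h1 : ∀ r : ℝ, Real.exp (-a * r ^ (2 : ℝ) - b * r)
      = Real.exp (b ^ 2 / (4 * a)) * Real.exp (-(Real.sqrt a * r + c) ^ 2) := by
    intro r
    rw [← Real.exp_add]
    congr 1
    have hbc : b = 2 * Real.sqrt a * c := by rw [hc]; field_simp
    have h2 : b ^ 2 / (4 * a) = c ^ 2 := by
      rw [hbc, mul_pow, mul_pow, hsq]; field_simp; ring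
    rw [h2, hbc, Real.rpow_two]
    linear_combination (-r ^ 2) * hsq.symm
  simp_rw [h1]
  rw [integral_const_mul]
  congr 1
  have h2 := integral_comp_mul_left_Ioi (fun s => Real.exp (-(s + c) ^ 2)) 0 hs
  rw [mul_zero, smul_eq_mul] at h2
  rw [h2]
  congr 1
  have h3 := (measurePreserving_add_right (volume : Measure ℝ) c).setIntegral_preimage_emb
    (measurableEmbedding_addRight c) (fun s => Real.exp (-s ^ 2)) (Set.Ioi c)
  rw [← h3]
  simp

/-! ### Closed forms in the network parameters -/

namespace Network

variable {K : ℕ} (net : Network K)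

lemma gam_pos (hN : 0 < net.N0) (k : Fin K) {βe : ℝ} (hβ : 0 < βe) : 0 < net.gam k βe := by
  have := net.phi_pos k
  have := net.pow_pos k
  have := Real.pi_pos
  unfold gam; positivity

/-- The normalisation of `γ` is such that the quadratic coefficient is `(π/2)² γ`; with linear
coefficient `πy` the Gaussian tail then starts at `y / √γ`. -/
lemma integral_closed_form (hN : 0 < net.N0) (k : Fin K) {βe : ℝ} (hβ : 0 < βe) {y : ℝ}
    (hy : 0 ≤ y) :
    ∫ r in Set.Ioi (0 : ℝ), Real.exp (-(βe * net.N0 / (net.phi k * net.pow k)) * r ^ (2 : ℝ)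
        - Real.pi * y * r)
      = Real.exp (y ^ 2 / net.gam k βe) * ((Real.sqrt Real.pi * Real.sqrt (net.gam k βe))⁻¹
        * (1 - Omega (y / Real.sqrt (net.gam k βe)))) := by
  have hφ := net.phi_pos k
  have hP := net.pow_pos k
  have hpi := Real.pi_pos
  have hγ := net.gam_pos hN k hβ
  have hγs : 0 < Real.sqrt (net.gam k βe) := Real.sqrt_pos.2 hγ
  have ha : βe * net.N0 / (net.phi k * net.pow k) = (Real.pi / 2) ^ 2 * net.gam k βe := by
    rw [gam]; field_simp; norm_num
  have hsqrt : Real.sqrt ((Real.pi / 2) ^ 2 * net.gam k βe)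
      = Real.pi / 2 * Real.sqrt (net.gam k βe) := by
    rw [Real.sqrt_mul (by positivity), Real.sqrt_sq (by positivity)]
  rw [integral_exp_neg_quadratic (by positivity) (by positivity), ha, hsqrt]
  have e1 : (Real.pi * y) ^ 2 / (4 * ((Real.pi / 2) ^ 2 * net.gam k βe))
      = y ^ 2 / net.gam k βe := by
    field_simp; norm_num
  have e2 : Real.pi * y / (2 * (Real.pi / 2 * Real.sqrt (net.gam k βe)))
      = y / Real.sqrt (net.gam k βe) := by
    field_simp
  have e3 : Real.pi = Real.sqrt Real.pi * Real.sqrt Real.pi := (Real.mul_self_sqrt hpi.le).symm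
  have hsp : 0 < Real.sqrt Real.pi := Real.sqrt_pos.2 hpi
  rw [e1, e2, ← mul_assoc (Real.pi / 2 * _)⁻¹]
  congr 2
  rw [mul_inv, mul_inv, inv_div]
  nth_rw 1 [e3]
  field_simp

lemma lowerIntegral_eq (hα : net.alpha = 4) (hN : 0 < net.N0) (A : Fin K → unitInterval)
    (k : Fin K) {βe : ℝ} (hβ : 0 < βe) :
    net.lowerIntegral A k βe = net.lowerClosed A k βe := by
  have hψ : 0 ≤ net.psi A k * βe ^ net.delta :=
    mul_nonneg (net.psi_nonneg A k) (Real.rpow_nonneg hβ.le _)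
  have hI := net.integral_closed_form hN k hβ hψ
  have hp : net.alpha / 2 = 2 := by rw [hα]; norm_num
  have hsq : (net.psi A k * βe ^ net.delta) ^ 2 = net.psi A k ^ 2 * βe ^ (2 * net.delta) := by
    rw [mul_pow, mul_comm 2, Real.rpow_mul hβ.le, Real.rpow_two]
  have hsp : 0 < Real.sqrt Real.pi := Real.sqrt_pos.2 Real.pi_pos
  rw [hsq, ← mul_assoc Real.pi] at hI
  rw [lowerIntegral, lowerClosed, hp, hI]
  congr 2
  nth_rw 1 [← Real.mul_self_sqrt Real.pi_pos.le]
  field_simp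

lemma upperIntegral_eq (hα : net.alpha = 4) (hN : 0 < net.N0) (A : Fin K → unitInterval)
    (k : Fin K) {βe : ℝ} (hβ : 0 < βe) :
    net.upperIntegral A k βe = net.upperClosed A k βe := by
  have hψ : 0 ≤ net.lamE + net.psi A k * βe ^ net.delta :=
    add_nonneg net.lamE_pos.le (mul_nonneg (net.psi_nonneg A k) (Real.rpow_nonneg hβ.le _))
  have hI := net.integral_closed_form hN k hβ hψ
  have hp : net.alpha / 2 = 2 := by rw [hα]; norm_num
  have hsp : 0 < Real.sqrt Real.pi := Real.sqrt_pos.2 Real.pi_pos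
  have hexp : ∀ r : ℝ, -(βe * net.N0 / (net.phi k * net.pow k)) * r ^ (2 : ℝ)
        - Real.pi * net.psi A k * βe ^ net.delta * r - Real.pi * net.lamE * r
      = -(βe * net.N0 / (net.phi k * net.pow k)) * r ^ (2 : ℝ)
        - Real.pi * (net.lamE + net.psi A k * βe ^ net.delta) * r := fun r => by ring
  rw [upperIntegral, upperClosed, hp]
  simp_rw [hexp]
  rw [hI]
  congr 1
  nth_rw 1 [← Real.mul_self_sqrt Real.pi_pos.le]
  field_simp

end Network

end

end SecrecyHCN

theorem corollary2 {K : ℕ} (net : SecrecyHCN.Network K) (hα : net.alpha = 4) (hN : 0 < net.N0)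
    (A : Fin K → unitInterval) (k : Fin K)
    {Ω : Type*} [MeasurableSpace Ω] (P : Measure Ω) [IsProbabilityMeasure P]
    (D : SecrecyHCN.Deployment net A k P) (βe : ℝ) (hβ : 0 < βe) :
    (net.lowerClosed A k βe ≤ D.secrecyProb βe ∧ D.secrecyProb βe ≤ net.upperClosed A k βe) ∧
      net.lowerIntegral A k βe = net.lowerClosed A k βe ∧
      net.upperIntegral A k βe = net.upperClosed A k βe := by
  have hL := net.lowerIntegral_eq hα hN A k hβ
  have hU := net.upperIntegral_eq hα hN A k hβ
  have h := D.secrecyProb_bounds hN hβ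
  rw [hL, hU] at h
  exact ⟨h, hL, hU⟩
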